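/- All manifolds are smooth, finite-dimensional, of constant dimension, Hausdorff, second countable and without boundary. Let $\mathscr G\rightrightarrows M$ be a Lie groupoid with source $s$, target $t$ and unit map $m\mapsto \mathrm{Id}_m$; $g.h$ is defined for $s(g)=t(h)$. A (global) bisection is a smooth section $\beta$ of $s$ such that $t_*\beta:=t\circ\beta$ is a diffeomorphism of $M$; bisections form a group $\mathbb B$ with $(\beta_2\cdot\beta_1)(m)=\beta_2(t(\beta_1(m))).\beta_1(m)$, which acts on the manifold $\mathscr G$ from the left by $L_\beta(g)=\beta(t(g)).g$ and from the right by $R_\beta(g)=g.\beta((t_*\beta)^{-1}(s(g)))$. $\mathscr G$ is $\mathrm{Id}$-reducible if for every $g\in\mathscr G$ there is $\beta\in\mathbb B$ with $\beta(s(g))=g$. Let $\pi\colon P\to\Sigma$ be a map between manifolds. A local trivialisation of $\pi$ over an open set $O\subset\Sigma$ is a diffeomorphism $\tau\colon\pi^{-1}(O)\to O\times\mathscr G$ over $O$. (a) A principaloid bundle structure on $\pi$ is a reduction of the structure group to $L(\mathbb B)$: an equivalence class (equivalently, a maximal one) of families of local trivialisations $\tau_i$ over open sets $O_i$ covering $\Sigma$,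 with $\tau_i\circ\tau_j^{-1}(\sigma,g)=(\sigma,L_{\beta_{ij}(\sigma)}(g))$ for families $\beta_{ij}\colon O_i\cap O_j\to\mathbb B$ for which $(\sigma,m)\mapsto\beta_{ij}(\sigma)(m)$ is smooth. It has a moment map $\mu\colon P\to M$ and a right $\mathscr G$-action $\varrho(p,h)=\varrho_h(p)$, defined for $\mu(p)=t(h)$, which in these trivialisations are given by $\mu(\sigma,g)=s(g)$ and $\varrho((\sigma,g),h)=(\sigma,g.h)$. A compatible connection on it is an Ehresmann connection $TP=\ker T\pi\oplus H$ with $H\subset\ker T\mu$ and $T_p\varrho_g(H_p)=H_{\varrho_g(p)}$ whenever $\mu(p)=t(g)$. (b) A $\mathscr G$-fibred $\mathbb B$-bundle structure on $\pi$ is a right action $\mathscr R$ of $\mathbb B$ on $P$ by diffeomorphisms that preserve the fibres of $\pi$, such that $\Sigma$ is covered by the domains of local trivialisations $\tau$ that are $\mathbb B$-equivariant, i.e. $\mathscr R_\beta\circ\tau^{-1}(\sigma,g)=\tau^{-1}(\sigma,R_\beta(g))$. A compatible connection on it is a $\mathbb B$-invariant Ehresmann connection: $T_p\mathscr R_\beta(H_p)=H_{\mathscr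 R_\beta(p)}$ for all $p\in P$, $\beta\in\mathbb B$. **Theorem.** Let $\mathscr G$ be $\mathrm{Id}$-reducible, and assume that the fibres of $t$ have positive dimension ($\dim\mathscr G>\dim M$) or that $M$ has at most one point. Then for every $\pi\colon P\to\Sigma$ there is a one-to-one correspondence between principaloid bundle structures on $\pi$ with compatible connection and $\mathscr G$-fibred $\mathbb B$-bundle structures on $\pi$ with compatible connection. It keeps the horizontal distribution $H$ unchanged, and sends a principaloid bundle structure to the $\mathbb B$-action given by $\mathscr R_\beta(p)=\varrho\bigl(p,\beta((t_*\beta)^{-1}(\mu(p)))\bigr)$, for which all the local trivialisations of the reduction are $\mathbb B$-equivariant. -/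

import Mathlib

open scoped Manifold ContDiff Topology

/-- A Lie groupoid with object manifold `M` (of dimension `dM`) and arrow manifold `G`
(of dimension `dG`). An arrow `g` goes from `s g` to `t g`, and `mul g h` is the product `g.h`,
which is meaningful for `s g = t h` only: every axiom on `mul` is restricted to composable
arrows, and so is every use of `mul` below. -/
structure LieGroupoid (dM dG : ℕ) (M G : Type*)
    [TopologicalSpace M] [ChartedSpace (EuclideanSpace ℝ (Fin dM)) M]
    [TopologicalSpace G] [ChartedSpace (EuclideanSpace ℝ (Fin dG)) G] where
  /-- source -/
  s : G → M
  /-- target -/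
  t : G → M
  /-- unit -/
  ident : M → G
  /-- inverse -/
  inv : G → G
  /-- multiplication -/
  mul : G → G → G
  s_ident : ∀ m, s (ident m) = m
  t_ident : ∀ m, t (ident m) = m
  s_mul : ∀ g h, s g = t h → s (mul g h) = s h
  t_mul : ∀ g h, s g = t h → t (mul g h) = t g
  mul_assoc : ∀ g h k, s g = t h → s h = t k → mul (mul g h) k = mul g (mul h k)
  ident_mul : ∀ g, mul (ident (t g)) g = g
  mul_ident : ∀ g, mul g (ident (s g)) = g
  s_inv : ∀ g, s (inv g) = t g
  t_inv : ∀ g, t (inv g) = s g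
  mul_inv : ∀ g, mul g (inv g) = ident (t g)
  inv_mul : ∀ g, mul (inv g) g = ident (s g)
  smooth_s : ContMDiff (𝓡 dG) (𝓡 dM) ∞ s
  smooth_t : ContMDiff (𝓡 dG) (𝓡 dM) ∞ t
  smooth_ident : ContMDiff (𝓡 dM) (𝓡 dG) ∞ ident
  smooth_inv : ContMDiff (𝓡 dG) (𝓡 dG) ∞ inv
  smooth_mul : ContMDiffOn ((𝓡 dG).prod (𝓡 dG)) (𝓡 dG) ∞
    (fun x : G × G => mul x.1 x.2) {x | s x.1 = t x.2}
  submersion_s : ∀ g, Function.Surjective (mfderiv (𝓡 dG) (𝓡 dM) s g)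
  submersion_t : ∀ g, Function.Surjective (mfderiv (𝓡 dG) (𝓡 dM) t g)

section Groupoid

variable {dM dG : ℕ} {M G : Type*}
  [TopologicalSpace M] [ChartedSpace (EuclideanSpace ℝ (Fin dM)) M]
  [TopologicalSpace G] [ChartedSpace (EuclideanSpace ℝ (Fin dG)) G]

/-- A global bisection: a smooth section `β` of the source map such that `t ∘ β` is a
diffeomorphism of `M`; that diffeomorphism (determined by `β`) is recorded as `shadow`. -/
structure Bisection (𝒢 : LieGroupoid dM dG M G) where
  /-- the underlying section -/
  toFun : M → G
  smooth : ContMDiff (𝓡 dM) (𝓡 dG) ∞ toFun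
  s_toFun : ∀ m, 𝒢.s (toFun m) = m
  /-- the diffeomorphism `t ∘ β` of `M` -/
  shadow : M ≃ₘ^∞⟮𝓡 dM, 𝓡 dM⟯ M
  shadow_apply : ∀ m, shadow m = 𝒢.t (toFun m)

namespace Bisection

variable {𝒢 : LieGroupoid dM dG M G}

instance : CoeFun (Bisection 𝒢) (fun _ => M → G) := ⟨Bisection.toFun⟩

/-- The unit bisection `Id`. -/
noncomputable instance : One (Bisection 𝒢) where
  one :=
    { toFun := 𝒢.ident
      smooth := 𝒢.smooth_ident
      s_toFun := 𝒢.s_ident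
      shadow := Diffeomorph.refl (𝓡 dM) M ∞
      shadow_apply := fun m => (𝒢.t_ident m).symm }

/-- The product `(β₂ · β₁)(m) = β₂(t(β₁(m))).β₁(m)` of bisections. -/
noncomputable instance : Mul (Bisection 𝒢) where
  mul β₂ β₁ :=
    { toFun := fun m => 𝒢.mul (β₂ (𝒢.t (β₁ m))) (β₁ m)
      smooth := by
        have h : ContMDiff (𝓡 dM) ((𝓡 dG).prod (𝓡 dG)) ∞
            (fun m => (β₂ (𝒢.t (β₁ m)), β₁ m)) :=
          (β₂.smooth.comp (𝒢.smooth_t.comp β₁.smooth)).prodMk β₁.smooth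
        exact 𝒢.smooth_mul.comp_contMDiff h (fun m => β₂.s_toFun _)
      s_toFun := fun m => by
        rw [𝒢.s_mul _ _ (β₂.s_toFun _), β₁.s_toFun]
      shadow := β₁.shadow.trans β₂.shadow
      shadow_apply := fun m => by
        rw [𝒢.t_mul _ _ (β₂.s_toFun _), Diffeomorph.coe_trans, Function.comp_apply,
          β₁.shadow_apply, β₂.shadow_apply] }

/-- Left multiplication `L_β(g) = β(t(g)).g` of arrows by a bisection. -/
noncomputable def L (β : Bisection 𝒢) (g : G) : G := 𝒢.mul (β (𝒢.t g)) g

/-- Right multiplication `R_β(g) = g.β((t ∘ β)⁻¹(s(g)))` of arrows by a bisection. -/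
noncomputable def R (β : Bisection 𝒢) (g : G) : G := 𝒢.mul g (β (β.shadow.symm (𝒢.s g)))

theorem s_L (β : Bisection 𝒢) (g : G) : 𝒢.s (β.L g) = 𝒢.s g :=
  𝒢.s_mul _ _ (β.s_toFun _)

theorem L_mul (β : Bisection 𝒢) (g h : G) (hc : 𝒢.s g = 𝒢.t h) :
    𝒢.mul (β.L g) h = β.L (𝒢.mul g h) := by
  unfold L
  rw [𝒢.mul_assoc _ _ _ (β.s_toFun _) hc, 𝒢.t_mul _ _ hc]

end Bisection

/-- Through every arrow there passes a global bisection. -/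
def LieGroupoid.IsIdReducible (𝒢 : LieGroupoid dM dG M G) : Prop :=
  ∀ g : G, ∃ β : Bisection 𝒢, β (𝒢.s g) = g

end Groupoid

section Bundles

variable {dM dG dX dP : ℕ} {M G X P : Type*}
  [TopologicalSpace M] [ChartedSpace (EuclideanSpace ℝ (Fin dM)) M]
  [TopologicalSpace G] [ChartedSpace (EuclideanSpace ℝ (Fin dG)) G]
  [TopologicalSpace X] [ChartedSpace (EuclideanSpace ℝ (Fin dX)) X]
  [TopologicalSpace P] [ChartedSpace (EuclideanSpace ℝ (Fin dP)) P]

/-- A local trivialisation `π⁻¹(O) ≃ O × G` is smooth if it and its inverse are smooth. -/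
def IsSmoothTriv (dG dX dP : ℕ) {G X P : Type*}
    [TopologicalSpace G] [ChartedSpace (EuclideanSpace ℝ (Fin dG)) G]
    [TopologicalSpace X] [ChartedSpace (EuclideanSpace ℝ (Fin dX)) X]
    [TopologicalSpace P] [ChartedSpace (EuclideanSpace ℝ (Fin dP)) P]
    {π : P → X} (τ : Bundle.Trivialization G π) : Prop :=
  ContMDiffOn (𝓡 dP) ((𝓡 dX).prod (𝓡 dG)) ∞ (fun p => τ p) τ.source ∧
  ContMDiffOn ((𝓡 dX).prod (𝓡 dG)) (𝓡 dP) ∞ (fun y => τ.toOpenPartialHomeomorph.symm y) τ.target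

/-- The transition map between two local trivialisations is `(σ, g) ↦ (σ, L_{β(σ)}(g))` for a
smooth family `β` of bisections over the intersection of their domains. -/
def LCompatible (dX : ℕ) {X : Type*} [TopologicalSpace X]
    [ChartedSpace (EuclideanSpace ℝ (Fin dX)) X]
    (𝒢 : LieGroupoid dM dG M G) {π : P → X} (τ τ' : Bundle.Trivialization G π) : Prop :=
  ∃ β : X → Bisection 𝒢,
    ContMDiffOn ((𝓡 dX).prod (𝓡 dM)) (𝓡 dG) ∞ (fun y : X × M => β y.1 y.2)
      ((τ.baseSet ∩ τ'.baseSet) ×ˢ Set.univ) ∧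
    ∀ σ ∈ τ.baseSet ∩ τ'.baseSet, ∀ g : G,
      τ (τ'.toOpenPartialHomeomorph.symm (σ, g)) = (σ, (β σ).L g)

/-- A principaloid bundle structure on `π : P → X`: a reduction of the structure group to `L(𝔹)`,
that is, an equivalence class of trivialising atlases with transition maps in `L(𝔹)`, given
through its maximal representative. -/
structure PrincipaloidBundle (dX dP : ℕ) {X P : Type*}
    [TopologicalSpace X] [ChartedSpace (EuclideanSpace ℝ (Fin dX)) X]
    [TopologicalSpace P] [ChartedSpace (EuclideanSpace ℝ (Fin dP)) P]
    (𝒢 : LieGroupoid dM dG M G) (π : P → X) where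
  /-- the local trivialisations that belong to the reduction -/
  atlas : Set (Bundle.Trivialization G π)
  smooth : ∀ τ ∈ atlas, IsSmoothTriv dG dX dP τ
  cover : ∀ σ : X, ∃ τ ∈ atlas, σ ∈ τ.baseSet
  compatible : ∀ τ ∈ atlas, ∀ τ' ∈ atlas, LCompatible dX 𝒢 τ τ'
  maximal : ∀ τ : Bundle.Trivialization G π, IsSmoothTriv dG dX dP τ →
    (∀ τ' ∈ atlas, LCompatible dX 𝒢 τ τ' ∧ LCompatible dX 𝒢 τ' τ) → τ ∈ atlas

namespace PrincipaloidBundle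

variable {𝒢 : LieGroupoid dM dG M G} {π : P → X}

/-- A chosen trivialisation of the atlas around `σ`. -/
noncomputable def trivAt (𝒜 : PrincipaloidBundle dX dP 𝒢 π) (σ : X) : Bundle.Trivialization G π :=
  (𝒜.cover σ).choose

/-- The moment map `μ : P → M`, equal to `(σ, g) ↦ s(g)` in each trivialisation of the atlas. -/
noncomputable def moment (𝒜 : PrincipaloidBundle dX dP 𝒢 π) (p : P) : M :=
  𝒢.s (𝒜.trivAt (π p) p).2

/-- The right `𝒢`-action `ϱ(p, h)`, meaningful for `μ(p) = t(h)`, equal to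
`((σ, g), h) ↦ (σ, g.h)` in each trivialisation of the atlas. -/
noncomputable def rho (𝒜 : PrincipaloidBundle dX dP 𝒢 π) (p : P) (h : G) : P :=
  (𝒜.trivAt (π p)).toOpenPartialHomeomorph.symm (π p, 𝒢.mul (𝒜.trivAt (π p) p).2 h)

theorem trivAt_mem (𝒜 : PrincipaloidBundle dX dP 𝒢 π) (σ : X) : 𝒜.trivAt σ ∈ 𝒜.atlas :=
  (𝒜.cover σ).choose_spec.1

theorem mem_trivAt (𝒜 : PrincipaloidBundle dX dP 𝒢 π) (σ : X) : σ ∈ (𝒜.trivAt σ).baseSet :=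
  (𝒜.cover σ).choose_spec.2

theorem exists_change (𝒜 : PrincipaloidBundle dX dP 𝒢 π) {τ : Bundle.Trivialization G π}
    (hτ : τ ∈ 𝒜.atlas) (p : P) (hp : π p ∈ τ.baseSet) :
    ∃ β : Bisection 𝒢, (𝒜.trivAt (π p) p).2 = β.L (τ p).2 ∧
      ∀ g, τ.toOpenPartialHomeomorph.symm (π p, g) =
        (𝒜.trivAt (π p)).toOpenPartialHomeomorph.symm (π p, β.L g) := by
  obtain ⟨β, -, h⟩ := 𝒜.compatible _ (𝒜.trivAt_mem (π p)) τ hτ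
  have hm : π p ∈ (𝒜.trivAt (π p)).baseSet ∩ τ.baseSet := ⟨𝒜.mem_trivAt _, hp⟩
  have key := h (π p) hm
  refine ⟨β (π p), ?_, fun g => ?_⟩
  · have e := key (τ p).2
    have hs : p ∈ τ.source := τ.mem_source.2 hp
    have e2 : (π p, (τ p).2) = τ p := by
      rw [← τ.coe_fst hs]
    have e3 : τ.toOpenPartialHomeomorph.symm (τ p) = p := τ.toOpenPartialHomeomorph.left_inv hs
    rw [e2, e3] at e
    rw [e]
  · have hq : τ.toOpenPartialHomeomorph.symm (π p, g) ∈ (𝒜.trivAt (π p)).source := by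
      rw [Bundle.Trivialization.mem_source]
      rw [τ.proj_symm_apply' hp]
      exact hm.1
    rw [← key g]
    exact ((𝒜.trivAt (π p)).toOpenPartialHomeomorph.left_inv hq).symm

/-- The moment map is `s` in every trivialisation of the atlas. -/
theorem moment_eq (𝒜 : PrincipaloidBundle dX dP 𝒢 π) {τ : Bundle.Trivialization G π}
    (hτ : τ ∈ 𝒜.atlas) (p : P) (hp : π p ∈ τ.baseSet) : 𝒜.moment p = 𝒢.s (τ p).2 := by
  obtain ⟨β, h, -⟩ := 𝒜.exists_change hτ p hp
  rw [moment, h, β.s_L]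

/-- The action is right translation in every trivialisation of the atlas. -/
theorem rho_eq (𝒜 : PrincipaloidBundle dX dP 𝒢 π) {τ : Bundle.Trivialization G π}
    (hτ : τ ∈ 𝒜.atlas) (p : P) (hp : π p ∈ τ.baseSet) (h : G) (hc : 𝒜.moment p = 𝒢.t h) :
    𝒜.rho p h = τ.toOpenPartialHomeomorph.symm (π p, 𝒢.mul (τ p).2 h) := by
  obtain ⟨β, h1, h2⟩ := 𝒜.exists_change hτ p hp
  rw [𝒜.moment_eq hτ p hp] at hc
  rw [rho, h1, h2, β.L_mul _ _ hc]

end PrincipaloidBundle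

/-- A `𝒢`-fibred `𝔹`-bundle structure on `π : P → X`: a right action of the group `𝔹` of
bisections by bundle automorphisms over the identity of `X`, such that `X` is covered by
the domains of smooth local trivialisations `π⁻¹(O) ≃ O × G` that intertwine it with the right
multiplication of `𝔹` on `G`. -/
structure GFibredBBundle (dX dP : ℕ) {X P : Type*}
    [TopologicalSpace X] [ChartedSpace (EuclideanSpace ℝ (Fin dX)) X]
    [TopologicalSpace P] [ChartedSpace (EuclideanSpace ℝ (Fin dP)) P]
    (𝒢 : LieGroupoid dM dG M G) (π : P → X) where
  /-- the action of bisections -/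
  act : Bisection 𝒢 → P → P
  act_one : ∀ p, act 1 p = p
  act_mul : ∀ β₁ β₂ p, act (β₁ * β₂) p = act β₂ (act β₁ p)
  smooth_act : ∀ β, ContMDiff (𝓡 dP) (𝓡 dP) ∞ (act β)
  proj_act : ∀ β p, π (act β p) = π p
  locally_trivial : ∀ σ : X, ∃ τ : Bundle.Trivialization G π, σ ∈ τ.baseSet ∧
    IsSmoothTriv dG dX dP τ ∧ ∀ β, ∀ p ∈ τ.source, τ (act β p) = (π p, β.R (τ p).2)

/-- An Ehresmann connection on `π : P → X`: a smooth distribution `H` on `P` that is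
complementary to the vertical distribution `ker Tπ`. Smoothness means that `H` has smooth local
frames. -/
structure EhresmannConnection (dX dP : ℕ) {X P : Type*}
    [TopologicalSpace X] [ChartedSpace (EuclideanSpace ℝ (Fin dX)) X]
    [TopologicalSpace P] [ChartedSpace (EuclideanSpace ℝ (Fin dP)) P]
    [IsManifold (𝓡 dP) ∞ P] (π : P → X) where
  /-- the horizontal subspaces -/
  H : ∀ p : P, Submodule ℝ (TangentSpace (𝓡 dP) p)
  isCompl : ∀ p, IsCompl (mfderiv (𝓡 dP) (𝓡 dX) π p).ker (H p)
  smooth : ∀ p₀ : P, ∃ U : Set P, IsOpen U ∧ p₀ ∈ U ∧ ∃ (k : ℕ)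
    (Y : Fin k → ∀ p : P, TangentSpace (𝓡 dP) p),
    (∀ i, ContMDiffOn (𝓡 dP) (𝓡 dP).tangent ∞
      (fun p => (⟨p, Y i p⟩ : TangentBundle (𝓡 dP) P)) U) ∧
    ∀ p ∈ U, LinearIndependent ℝ (fun i => Y i p) ∧
      Submodule.span ℝ (Set.range fun i => Y i p) = H p

variable [IsManifold (𝓡 dP) ∞ P] {𝒢 : LieGroupoid dM dG M G} {π : P → X}

/-- A compatible connection on a principaloid bundle: `H ⊆ ker Tμ`, and `Tϱ_g` maps `H_p` onto
`H_{ϱ_g(p)}` for all `p` with `μ(p) = t(g)`. Here `ϱ_g` is a map on the submanifold `μ⁻¹(t(g))`,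
whose tangent space `ker T_pμ` contains `H_p`; `D` is a derivative of `ϱ_g` within this submanifold,
so its restriction to `ker T_pμ` is the tangent map `T_pϱ_g`. -/
def PrincipaloidBundle.IsCompatible (𝒜 : PrincipaloidBundle dX dP 𝒢 π)
    (C : EhresmannConnection dX dP π) : Prop :=
  (∀ p, C.H p ≤ (mfderiv (𝓡 dP) (𝓡 dM) 𝒜.moment p).ker) ∧
  ∀ (g : G) (p : P), 𝒜.moment p = 𝒢.t g →
    ∃ D : TangentSpace (𝓡 dP) p →L[ℝ] TangentSpace (𝓡 dP) (𝒜.rho p g),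
      HasMFDerivWithinAt (𝓡 dP) (𝓡 dP) (fun q => 𝒜.rho q g) {q | 𝒜.moment q = 𝒢.t g} p D ∧
      (C.H p).map D.toLinearMap = C.H (𝒜.rho p g)

/-- A compatible connection on a `𝒢`-fibred `𝔹`-bundle is a `𝔹`-invariant one. -/
def GFibredBBundle.IsCompatible (𝒬 : GFibredBBundle dX dP 𝒢 π)
    (C : EhresmannConnection dX dP π) : Prop :=
  ∀ (β : Bisection 𝒢) (p : P),
    (C.H p).map (mfderiv (𝓡 dP) (𝓡 dP) (𝒬.act β) p).toLinearMap = C.H (𝒬.act β p)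

end Bundles

/-! Left and right translations commute (`Bisection.L_R`), so right translation by a bisection, read
in any trivialisation of the reduction, is a well-defined action on `P`. Conversely, an action
yields the atlas of all its smooth equivariant trivialisations. For these constructions to be
mutually inverse, a fibrewise transition map, that is a diffeomorphism `f` of `G` commuting with
every `R_β`, must be a left translation (`LieGroupoid.IsIdReducible.exists_L_eq`). By
`Id`-reducibility every arrow `g` is `R_β` of the unit at `t(g)`, so `f` is determined by its values
on units. It is left multiplication by these values as soon as `s(f(Id_m)) = m`. Were this source a
point `n ≠ m`, a bisection trivial at `m` but not at `n` would fix `Id_m` and move `f(Id_m)`, which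
contradicts equivariance.

For connections, the action of `β` agrees with `ϱ_g`, for `g = β((t_*β)⁻¹(μ(p)))`, on the level set
of `μ` through `p`, so the two derivatives agree on `ker T_pμ`. It remains to see that a
`𝔹`-invariant `H` lies in `ker Tμ`. If `β` is trivial at `μ(p)`, its action fixes `p`, covers the
identity and preserves `H_p`, hence its derivative is the identity on `H_p`
(`EhresmannConnection.apply_eq_self`). Then `Tβ` and the derivative of the unit section agree on
`Tμ(H_p)` (`PrincipaloidBundle.mfderiv_bisection_eq`). A nonzero vector there is excluded by a
bisection through the same unit with a different derivative on it.

Both arguments need many bisections near the unit, and here the dimension hypothesis enters; for `M`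
with at most one point they are not needed. A nonzero vector in `ker Ts` deforms the unit section
through local sections `γ(ε, ·)`. Replacing `ε` by `ε χ(x)` with `χ` compactly supported, and
extending by units, gives global sections, whose composite with `t` is a small perturbation of the
identity and hence a diffeomorphism (`LieGroupoid.exists_bump_bisections`). A bump function
separates points; a bump function times a linear form separates tangent vectors. -/

/-! ### Local retractions onto the fibres of a submersion of vector spaces -/

section VectorSpace

variable {E F : Type*} [NormedAddCommGroup E] [NormedSpace ℝ E] [FiniteDimensional ℝ E]
  [NormedAddCommGroup F] [NormedSpace ℝ F] [FiniteDimensional ℝ F]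

omit [FiniteDimensional ℝ F] in
/-- The inverse of a smooth open partial homeomorphism is smooth near the image of a point with
invertible derivative. -/
theorem OpenPartialHomeomorph.eventually_contDiffAt_symm (e : OpenPartialHomeomorph E F) {a : E}
    (ha : a ∈ e.source) (hs : ∀ᶠ z in 𝓝 a, ContDiffAt ℝ ∞ e z)
    (hd : (fderiv ℝ e a).IsInvertible) : ∀ᶠ z in 𝓝 (e a), ContDiffAt ℝ ∞ e.symm z := by
  have hc : ContinuousAt (fderiv ℝ e) a :=
    (hs.self_of_nhds.fderiv_right (m := 0) (by simp)).continuousAt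
  have hinv : ∀ᶠ z in 𝓝 a, (fderiv ℝ e z).IsInvertible := by
    obtain ⟨L, hL⟩ := hd
    have : Set.range ((↑) : (E ≃L[ℝ] F) → E →L[ℝ] F) ∈ 𝓝 (fderiv ℝ e a) := by
      rw [← hL]; exact ContinuousLinearEquiv.nhds L
    filter_upwards [hc this] with z hz using hz
  have ht : Filter.Tendsto e.symm (𝓝 (e a)) (𝓝 a) := e.tendsto_symm ha
  filter_upwards [ht.eventually hinv, ht.eventually hs,
    e.open_target.mem_nhds (e.map_source ha)] with z hz hz2 hz3
  obtain ⟨L, hL⟩ := hz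
  refine e.contDiffAt_symm hz3 (f₀' := L) ?_ hz2
  rw [hL]
  exact (hz2.differentiableAt (by simp)).hasFDerivAt

/-- A submersion admits a smooth family of local retractions onto its fibres. -/
theorem exists_fibre_retraction {f : E → F} {a : E} (hf : ∀ᶠ z in 𝓝 a, ContDiffAt ℝ ∞ f z)
    (hs : Function.Surjective (fderiv ℝ f a)) :
    ∃ Λ : F × E → E, (∀ᶠ z in 𝓝 (f a, a), ContDiffAt ℝ ∞ Λ z) ∧
      (∀ᶠ z in 𝓝 (f a, a), f (Λ z) = z.1) ∧ ∀ᶠ e in 𝓝 a, Λ (f e, e) = e := by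
  have hsd : HasStrictFDerivAt f (fderiv ℝ f a) a :=
    hf.self_of_nhds.hasStrictFDerivAt (by simp)
  -- Pairing `f` with an affine projection onto the kernel of its derivative gives a local chart. `Λ
  -- (y, e)` will be the point with `f`-value `y` and the same kernel coordinate as `e`.
  let φ := HasStrictFDerivAt.implicitFunctionDataOfComplemented f (fderiv ℝ f a) hsd
    (LinearMap.range_eq_top.2 hs) (Submodule.ClosedComplemented.of_finiteDimensional _)
  have hl : φ.leftFun = f := rfl
  have hpt : φ.pt = a := rfl
  have hr : ContDiff ℝ ∞ φ.rightFun := by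
    change ContDiff ℝ ∞ fun x => (Classical.choose _ : E →L[ℝ] _) (x - a)
    fun_prop
  have hsymm : ∀ᶠ z in 𝓝 (φ.prodFun a), ContDiffAt ℝ ∞ φ.toOpenPartialHomeomorph.symm z := by
    refine φ.toOpenPartialHomeomorph.eventually_contDiffAt_symm
      φ.pt_mem_toOpenPartialHomeomorph_source ?_ ?_
    · filter_upwards [hf] with z hz
      rw [φ.toOpenPartialHomeomorph_coe]
      exact hz.prodMk hr.contDiffAt
    · exact φ.isInvertible_fderiv_prodFun
  have hcont : Filter.Tendsto (fun z : F × E => (z.1, φ.rightFun z.2)) (𝓝 (f a, a))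
      (𝓝 (φ.prodFun a)) := by
    have : Continuous (fun z : F × E => (z.1, φ.rightFun z.2)) :=
      continuous_fst.prodMk (hr.continuous.comp continuous_snd)
    exact this.tendsto (f a, a)
  refine ⟨fun z => φ.toOpenPartialHomeomorph.symm (z.1, φ.rightFun z.2), ?_, ?_, ?_⟩
  · filter_upwards [hcont.eventually hsymm] with z hz
    exact ContDiffAt.comp z hz
      (contDiffAt_fst.prodMk (hr.contDiffAt.comp z contDiffAt_snd))
  · filter_upwards [hcont.eventually φ.leftFun_implicitFunction] with z hz
    exact hz
  · exact φ.implicitFunction_apply_image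

omit [FiniteDimensional ℝ E] [FiniteDimensional ℝ F] in
/-- The family of retractions restricts to the identity on the tangent space of the fibre. -/
theorem fibre_retraction_deriv {f : E → F} {a : E} (hf : DifferentiableAt ℝ f a)
    {Λ : F × E → E} {Λ' : F × E →L[ℝ] E} (hΛ : HasFDerivAt Λ Λ' (f a, a))
    (h : ∀ᶠ e in 𝓝 a, Λ (f e, e) = e) {v : E} (hv : fderiv ℝ f a v = 0) : Λ' (0, v) = v := by
  have h1 : HasFDerivAt (fun e => Λ (f e, e)) (Λ'.comp ((fderiv ℝ f a).prod (.id ℝ E))) a :=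
    HasFDerivAt.comp a (f := fun e => (f e, e)) hΛ (hf.hasFDerivAt.prodMk (hasFDerivAt_id a))
  have h2 : HasFDerivAt (fun e => Λ (f e, e)) (.id ℝ E) a :=
    (hasFDerivAt_id a).congr_of_eventuallyEq h
  have := congrArg (fun L => L v) (h1.unique h2)
  simpa [hv] using this

end VectorSpace

/-! ### Diffeomorphisms close to the identity -/

section Perturbation

variable {E : Type*} [NormedAddCommGroup E] [NormedSpace ℝ E] [FiniteDimensional ℝ E]

/-- A smooth perturbation of the identity by a map with derivative of norm at most `1/2` is a
diffeomorphism. -/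
theorem exists_diffeo_of_fderiv_le {h : E → E} (hs : ContDiff ℝ ∞ h)
    (hd : ∀ x, ‖fderiv ℝ h x‖ ≤ 1 / 2) :
    ∃ Ψ : E ≃ E, (∀ x, Ψ x = x + h x) ∧ ContDiff ℝ ∞ Ψ ∧ ContDiff ℝ ∞ Ψ.symm := by
  have hlip : LipschitzWith (1 / 2) h :=
    lipschitzWith_of_nnnorm_fderiv_le (hs.differentiable (by simp)) fun x => by
      have := hd x
      rw [← NNReal.coe_le_coe]; simpa using this
  have happ : ApproximatesLinearOn (fun x => x + h x)
      ((ContinuousLinearEquiv.refl ℝ E : E ≃L[ℝ] E) : E →L[ℝ] E) Set.univ (1 / 2) := by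
    intro x _ y _
    have := hlip.dist_le_mul x y
    rw [dist_eq_norm, dist_eq_norm] at this
    convert! this using 2
    simp; abel
  -- The identity has norm 1 only on a nontrivial space, so the zero space is a separate case.
  have hc : Subsingleton E ∨
      (1 / 2 : NNReal) < ‖((ContinuousLinearEquiv.refl ℝ E).symm : E →L[ℝ] E)‖₊⁻¹ := by
    rcases subsingleton_or_nontrivial E with h | h
    · exact Or.inl h
    · right
      have : ‖((ContinuousLinearEquiv.refl ℝ E).symm : E →L[ℝ] E)‖₊ = 1 := by
        ext; simp
      rw [this]
      rw [← NNReal.coe_lt_coe]; norm_num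
  let Ψ := happ.toHomeomorph _ hc
  have hΨ : ∀ x, Ψ x = x + h x := fun x => rfl
  have hΨs : ContDiff ℝ ∞ Ψ := (contDiff_id.add hs : ContDiff ℝ ∞ fun x => x + h x)
  refine ⟨Ψ.toEquiv, hΨ, hΨs, ?_⟩
  rw [contDiff_iff_contDiffAt]
  intro y
  -- The derivative `1 + Dh` is invertible by the Neumann series, so the inverse function theorem
  -- makes the inverse homeomorphism smooth.
  have hlt : ‖-fderiv ℝ h (Ψ.symm y)‖ < 1 := by
    rw [norm_neg]; exact (hd _).trans_lt (by norm_num)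
  refine Ψ.toOpenPartialHomeomorph.contDiffAt_symm (by simp)
    (f₀' := ContinuousLinearEquiv.ofUnit (Units.oneSub _ hlt)) ?_ hΨs.contDiffAt
  have : HasFDerivAt (fun x => x + h x) (.id ℝ E + fderiv ℝ h (Ψ.symm y)) (Ψ.symm y) :=
    (hasFDerivAt_id _).add (hs.differentiable (by simp) _).hasFDerivAt
  convert! this using 1
  ext v
  change (Units.oneSub (-fderiv ℝ h (Ψ.symm y)) hlt : E →L[ℝ] E) v = _
  simp [Units.val_oneSub]

/-- If `F ε` is a smooth family of maps with `F 0 = id`, then for a bump function `χ` and small `ε`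
the map `x ↦ F (ε * χ x) x` is a diffeomorphism. -/
theorem eventually_exists_diffeo {F : ℝ × E → E} {δ r : ℝ} {x₀ : E}
    (hF : ContDiffOn ℝ ∞ F (Metric.ball 0 δ ×ˢ Metric.ball x₀ r)) (hδ : 0 < δ)
    (hF0 : ∀ x ∈ Metric.ball x₀ r, F (0, x) = x) {χ : E → ℝ} (hχ : ContDiff ℝ ∞ χ)
    (hsupp : tsupport χ ⊆ Metric.ball x₀ r) :
    ∀ᶠ ε in 𝓝 (0 : ℝ), (∀ x, ε * χ x ∈ Metric.ball (0 : ℝ) δ) ∧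
      ∃ Ψ : E ≃ E, ContDiff ℝ ∞ Ψ ∧ ContDiff ℝ ∞ Ψ.symm ∧
      (∀ x ∈ Metric.ball x₀ r, Ψ x = F (ε * χ x, x)) ∧ ∀ x ∉ tsupport χ, Ψ x = x := by
  classical
  have hK : IsCompact (tsupport χ) :=
    Metric.isCompact_of_isClosed_isBounded (isClosed_tsupport χ) (Metric.isBounded_ball.subset hsupp)
  obtain ⟨c, hc⟩ : ∃ c, ∀ x, ‖χ x‖ ≤ c := by
    obtain ⟨c, hc⟩ := hK.exists_bound_of_continuousOn hχ.continuous.continuousOn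
    refine ⟨max c 0, fun x => ?_⟩
    by_cases hx : x ∈ tsupport χ
    · exact (hc x hx).trans (le_max_left _ _)
    · rw [image_eq_zero_of_notMem_tsupport hx]; simp
  let W : Set ℝ := {ε | ∀ x, ε * χ x ∈ Metric.ball (0 : ℝ) δ}
  have hWnhds : Metric.ball (0 : ℝ) (δ / (|c| + 1)) ⊆ W := by
    intro ε hε x
    rw [mem_ball_zero_iff] at hε ⊢
    rw [norm_mul]
    have : ‖ε‖ * ‖χ x‖ ≤ ‖ε‖ * (|c| + 1) :=
      mul_le_mul_of_nonneg_left (((hc x).trans (le_abs_self c)).trans (by linarith)) (norm_nonneg _)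
    refine this.trans_lt ?_
    rwa [lt_div_iff₀ (by positivity)] at hε
  set V := Metric.ball (0 : ℝ) (δ / (|c| + 1))
  have hVo : IsOpen V := Metric.isOpen_ball
  have h0V : (0 : ℝ) ∈ V := Metric.mem_ball_self (by positivity)
  -- The displacement of `x`, extended by zero outside the ball. The two pieces match because off
  -- the support of `χ` the parameter is `0` and `F (0, x) = x`.
  let H : ℝ × E → E := fun z => if z.2 ∈ Metric.ball x₀ r then F (z.1 * χ z.2, z.2) - z.2 else 0
  have hHzero : ∀ ε ∈ V, ∀ x ∉ tsupport χ, H (ε, x) = 0 := by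
    intro ε _ x hx
    simp only [H]
    split_ifs with h
    · rw [image_eq_zero_of_notMem_tsupport hx, mul_zero, hF0 x h, sub_self]
    · rfl
  have hH0 : ∀ x, H (0, x) = 0 := by
    intro x
    simp only [H]
    split_ifs with h
    · rw [zero_mul, hF0 x h, sub_self]
    · rfl
  have hHs : ∀ z : ℝ × E, z.1 ∈ V → ContDiffAt ℝ ∞ H z := by
    rintro ⟨ε, x⟩ hε
    by_cases hx : x ∈ Metric.ball x₀ r
    · have h1 : ContDiffAt ℝ ∞ (fun z : ℝ × E => F (z.1 * χ z.2, z.2) - z.2) (ε, x) := by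
        have hFa : ContDiffAt ℝ ∞ F (ε * χ x, x) :=
          hF.contDiffAt ((Metric.isOpen_ball.prod Metric.isOpen_ball).mem_nhds
            ⟨hWnhds hε x, hx⟩)
        have h2 : ContDiffAt ℝ ∞ (fun z : ℝ × E => (z.1 * χ z.2, z.2)) (ε, x) := by
          have := hχ.comp (contDiff_snd (𝕜 := ℝ) (E := ℝ) (F := E))
          exact ((contDiff_fst.mul this).prodMk contDiff_snd).contDiffAt
        exact (ContDiffAt.comp (ε, x) (g := F) hFa h2).sub contDiffAt_snd
      refine h1.congr_of_eventuallyEq ?_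
      have : Set.univ ×ˢ Metric.ball x₀ r ∈ 𝓝 (ε, x) :=
        (isOpen_univ.prod Metric.isOpen_ball).mem_nhds ⟨trivial, hx⟩
      filter_upwards [this] with z hz
      exact if_pos hz.2
    · have hx' : x ∉ tsupport χ := fun h => hx (hsupp h)
      refine (contDiffAt_const (c := (0 : E))).congr_of_eventuallyEq ?_
      have : V ×ˢ (tsupport χ)ᶜ ∈ 𝓝 (ε, x) :=
        (hVo.prod (isClosed_tsupport χ).isOpen_compl).mem_nhds ⟨hε, hx'⟩
      filter_upwards [this] with z hz
      exact hHzero z.1 hz.1 z.2 hz.2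
  -- the partial derivative in the direction of `E`
  have hpart : ∀ z : ℝ × E, z.1 ∈ V →
      fderiv ℝ (fun x => H (z.1, x)) z.2 = (fderiv ℝ H z).comp (.inr ℝ ℝ E) := by
    intro z hz
    have h1 : HasFDerivAt H (fderiv ℝ H z) (z.1, z.2) :=
      ((hHs z hz).differentiableAt (by simp)).hasFDerivAt
    exact (HasFDerivAt.comp z.2 (f := fun x => (z.1, x)) h1 (hasFDerivAt_prodMk_right z.1 z.2)).fderiv
  have hdc : ∀ z : ℝ × E, z.1 ∈ V →
      ContinuousAt (fun z => ‖(fderiv ℝ H z).comp (.inr ℝ ℝ E)‖) z := by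
    intro z hz
    have h1 : ContinuousAt (fderiv ℝ H) z :=
      ((hHs z hz).fderiv_right (m := 0) (by simp)).continuousAt
    exact (h1.clm_comp continuousAt_const).norm
  -- At `ε = 0` the displacement vanishes identically. Continuity of its derivative and compactness
  -- of the support bound it uniformly for small `ε`.
  have htube : ∀ᶠ ε in 𝓝 (0 : ℝ), ∀ x ∈ tsupport χ,
      ‖(fderiv ℝ H (ε, x)).comp (.inr ℝ ℝ E)‖ < 1 / 2 := by
    refine hK.eventually_forall_of_forall_eventually fun x hx => ?_
    refine (hdc (0, x) h0V).eventually_lt continuousAt_const ?_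
    rw [← hpart (0, x) h0V]
    have : (fun x => H ((0 : ℝ), x)) = fun _ => 0 := funext hH0
    simp [this]
  filter_upwards [htube, hVo.mem_nhds h0V] with ε hε hεV
  refine ⟨hWnhds hεV, ?_⟩
  have hs : ContDiff ℝ ∞ (fun x => H (ε, x)) := by
    rw [contDiff_iff_contDiffAt]
    intro x
    exact ContDiffAt.comp x (g := H) (f := fun x => (ε, x)) (hHs (ε, x) hεV)
      (contDiffAt_const.prodMk contDiffAt_id)
  obtain ⟨Ψ, hΨ, hΨ1, hΨ2⟩ := exists_diffeo_of_fderiv_le hs (fun x => by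
    by_cases hx : x ∈ tsupport χ
    · rw [hpart (ε, x) hεV]; exact (hε x hx).le
    · have : (fun x => H (ε, x)) =ᶠ[𝓝 x] fun _ => 0 := by
        filter_upwards [(isClosed_tsupport χ).isOpen_compl.mem_nhds hx] with y hy
        exact hHzero ε hεV y hy
      rw [this.fderiv_eq]; simp)
  refine ⟨Ψ, hΨ1, hΨ2, fun x hx => ?_, fun x hx => ?_⟩
  · rw [hΨ]; simp only [H]; rw [if_pos hx]; abel
  · rw [hΨ, hHzero ε hεV x hx, add_zero]

end Perturbation

/-! ### Extending compactly supported maps from a chart to the manifold -/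

section Extension

variable {d : ℕ} {M : Type*} [TopologicalSpace M] [ChartedSpace (EuclideanSpace ℝ (Fin d)) M]
  [IsManifold (𝓡 d) ∞ M] [T2Space M]

omit [IsManifold (𝓡 d) ∞ M] in
/-- A map that is smooth on a chart domain and agrees with a smooth map off a compact subset of
this domain is smooth. -/
theorem contMDiff_of_eq_off_compact {d' : ℕ} {N : Type*} [TopologicalSpace N]
    [ChartedSpace (EuclideanSpace ℝ (Fin d')) N] (n : M) {K : Set (EuclideanSpace ℝ (Fin d))}
    (hK : IsCompact K) (hKt : K ⊆ (extChartAt (𝓡 d) n).target) {f g : M → N}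
    (hg : ContMDiff (𝓡 d) (𝓡 d') ∞ g)
    (hf : ∀ y ∈ (extChartAt (𝓡 d) n).source, extChartAt (𝓡 d) n y ∈ K →
      ContMDiffAt (𝓡 d) (𝓡 d') ∞ f y)
    (hfg : ∀ y, (y ∈ (extChartAt (𝓡 d) n).source → extChartAt (𝓡 d) n y ∉ K) → f y = g y) :
    ContMDiff (𝓡 d) (𝓡 d') ∞ f := by
  -- Here the Hausdorff property is needed: a compact subset of the chart domain is closed in the
  -- whole manifold, so `f = g` on the open complement.
  have hcl : IsClosed ((extChartAt (𝓡 d) n).symm '' K) :=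
    (hK.image_of_continuousOn ((continuousOn_extChartAt_symm n).mono hKt)).isClosed
  have hmem : ∀ y, y ∈ (extChartAt (𝓡 d) n).symm '' K ↔
      y ∈ (extChartAt (𝓡 d) n).source ∧ extChartAt (𝓡 d) n y ∈ K := by
    intro y
    constructor
    · rintro ⟨x, hx, rfl⟩
      exact ⟨(extChartAt (𝓡 d) n).map_target (hKt hx),
        by rwa [(extChartAt (𝓡 d) n).right_inv (hKt hx)]⟩
    · rintro ⟨h1, h2⟩
      exact ⟨_, h2, (extChartAt (𝓡 d) n).left_inv h1⟩
  intro y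
  by_cases hy : y ∈ (extChartAt (𝓡 d) n).symm '' K
  · exact hf y ((hmem y).1 hy).1 ((hmem y).1 hy).2
  · refine (hg y).congr_of_eventuallyEq ?_
    filter_upwards [hcl.isOpen_compl.mem_nhds hy] with z hz
    exact hfg z fun h1 h2 => hz ((hmem z).2 ⟨h1, h2⟩)

open Classical in
/-- A self-map of the model space, transported to a chart domain and extended by the identity. -/
noncomputable def chartExtend (n : M)
    (Ψ : EuclideanSpace ℝ (Fin d) → EuclideanSpace ℝ (Fin d)) (y : M) : M :=
  if y ∈ (extChartAt (𝓡 d) n).source then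
    (extChartAt (𝓡 d) n).symm (Ψ (extChartAt (𝓡 d) n y)) else y

omit [IsManifold (𝓡 d) ∞ M] [T2Space M] in
theorem chartExtend_of_mem {n : M} {Ψ : EuclideanSpace ℝ (Fin d) → EuclideanSpace ℝ (Fin d)} {y : M}
    (hy : y ∈ (extChartAt (𝓡 d) n).source) :
    chartExtend n Ψ y = (extChartAt (𝓡 d) n).symm (Ψ (extChartAt (𝓡 d) n y)) := if_pos hy

omit [IsManifold (𝓡 d) ∞ M] [T2Space M] in
theorem chartExtend_of_notMem {n : M} {Ψ : EuclideanSpace ℝ (Fin d) → EuclideanSpace ℝ (Fin d)}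
    {y : M} (hy : y ∉ (extChartAt (𝓡 d) n).source) : chartExtend n Ψ y = y := if_neg hy

omit [IsManifold (𝓡 d) ∞ M] [T2Space M] in
theorem chartExtend_leftInverse {n : M} {Ψ Ψ' : EuclideanSpace ℝ (Fin d) → EuclideanSpace ℝ (Fin d)}
    (h : Function.LeftInverse Ψ' Ψ)
    (ht : ∀ x ∈ (extChartAt (𝓡 d) n).target, Ψ x ∈ (extChartAt (𝓡 d) n).target) :
    Function.LeftInverse (chartExtend n Ψ') (chartExtend n Ψ) := by
  intro y
  by_cases hy : y ∈ (extChartAt (𝓡 d) n).source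
  · have h1 := ht _ ((extChartAt (𝓡 d) n).map_source hy)
    rw [chartExtend_of_mem hy, chartExtend_of_mem ((extChartAt (𝓡 d) n).map_target h1),
      (extChartAt (𝓡 d) n).right_inv h1, h, (extChartAt (𝓡 d) n).left_inv hy]
  · rw [chartExtend_of_notMem hy, chartExtend_of_notMem hy]

theorem contMDiff_chartExtend {n : M} {Ψ : EuclideanSpace ℝ (Fin d) → EuclideanSpace ℝ (Fin d)}
    (hΨ : ContDiff ℝ ∞ Ψ) {K : Set (EuclideanSpace ℝ (Fin d))} (hK : IsCompact K)
    (hKt : K ⊆ (extChartAt (𝓡 d) n).target) (hid : ∀ x ∉ K, Ψ x = x)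
    (ht : ∀ x ∈ (extChartAt (𝓡 d) n).target, Ψ x ∈ (extChartAt (𝓡 d) n).target) :
    ContMDiff (𝓡 d) (𝓡 d) ∞ (chartExtend n Ψ) := by
  refine contMDiff_of_eq_off_compact n hK hKt contMDiff_id (fun y hy _ => ?_) (fun y hy => ?_)
  · have h1 : ContMDiffAt (𝓡 d) (𝓡 d) ∞ (fun y => (extChartAt (𝓡 d) n).symm
        (Ψ (extChartAt (𝓡 d) n y))) y := by
      have h2 : ContMDiffAt (𝓡 d) 𝓘(ℝ, EuclideanSpace ℝ (Fin d)) ∞ (extChartAt (𝓡 d) n) y :=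
        contMDiffAt_extChartAt' (by simpa using hy)
      have h3 : ContMDiffAt 𝓘(ℝ, EuclideanSpace ℝ (Fin d)) (𝓡 d) ∞ (extChartAt (𝓡 d) n).symm
          (Ψ (extChartAt (𝓡 d) n y)) :=
        (contMDiffOn_extChartAt_symm n).contMDiffAt
          ((isOpen_extChartAt_target n).mem_nhds (ht _ ((extChartAt (𝓡 d) n).map_source hy)))
      exact ContMDiffAt.comp y (g := (extChartAt (𝓡 d) n).symm)
        (f := fun y => Ψ (extChartAt (𝓡 d) n y)) h3 (hΨ.contMDiff.contMDiffAt.comp y h2)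
    refine h1.congr_of_eventuallyEq ?_
    filter_upwards [(isOpen_extChartAt_source n).mem_nhds hy] with z hz
    exact chartExtend_of_mem hz
  · by_cases h : y ∈ (extChartAt (𝓡 d) n).source
    · rw [chartExtend_of_mem h, hid _ (hy h), (extChartAt (𝓡 d) n).left_inv h]; rfl
    · exact chartExtend_of_notMem h

/-- A compactly supported diffeomorphism of a chart image extends to the manifold. -/
theorem exists_diffeomorph_chartExtend (n : M)
    (Ψ : EuclideanSpace ℝ (Fin d) ≃ EuclideanSpace ℝ (Fin d)) (hΨ : ContDiff ℝ ∞ Ψ)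
    (hΨ' : ContDiff ℝ ∞ Ψ.symm) {K : Set (EuclideanSpace ℝ (Fin d))} (hK : IsCompact K)
    (hKt : K ⊆ (extChartAt (𝓡 d) n).target) (hid : ∀ x ∉ K, Ψ x = x) :
    ∃ S : M ≃ₘ^∞⟮𝓡 d, 𝓡 d⟯ M, ∀ y, S y = chartExtend n Ψ y := by
  have hid' : ∀ x ∉ K, Ψ.symm x = x := fun x hx => by
    rw [Ψ.symm_apply_eq, hid x hx]
  have aux : ∀ Θ : EuclideanSpace ℝ (Fin d) ≃ EuclideanSpace ℝ (Fin d), (∀ x ∉ K, Θ x = x) →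
      ∀ x ∈ (extChartAt (𝓡 d) n).target, Θ x ∈ (extChartAt (𝓡 d) n).target := by
    intro Θ h x hx
    by_cases h1 : Θ x ∈ K
    · exact hKt h1
    -- If `Θ x` is outside `K`, it is fixed by `Θ`, so `Θ x = x` by injectivity.
    · rwa [Θ.injective (h _ h1)]
  exact ⟨{ toFun := chartExtend n Ψ
           invFun := chartExtend n Ψ.symm
           left_inv := chartExtend_leftInverse Ψ.symm_apply_apply (aux Ψ hid)
           right_inv := chartExtend_leftInverse Ψ.apply_symm_apply (aux Ψ.symm hid')
           contMDiff_toFun := contMDiff_chartExtend hΨ hK hKt hid (aux Ψ hid)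
           contMDiff_invFun := contMDiff_chartExtend hΨ' hK hKt hid' (aux Ψ.symm hid') },
    fun _ => rfl⟩

end Extension

/-! ### Smooth maps between manifolds in charts -/

section ChartExpression

variable {d d' : ℕ} {M N : Type*} [TopologicalSpace M] [ChartedSpace (EuclideanSpace ℝ (Fin d)) M]
  [IsManifold (𝓡 d) ∞ M] [TopologicalSpace N] [ChartedSpace (EuclideanSpace ℝ (Fin d')) N]
  [IsManifold (𝓡 d') ∞ N]

/-- A smooth map is smooth in charts. -/
theorem ContMDiff.contDiffAt_chart {f : M → N} (hf : ContMDiff (𝓡 d) (𝓡 d') ∞ f) (n : M) (n' : N)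
    {z : EuclideanSpace ℝ (Fin d)} (hz : z ∈ (extChartAt (𝓡 d) n).target)
    (hz' : f ((extChartAt (𝓡 d) n).symm z) ∈ (extChartAt (𝓡 d') n').source) :
    ContDiffAt ℝ ∞ (fun z => extChartAt (𝓡 d') n' (f ((extChartAt (𝓡 d) n).symm z))) z := by
  have h := (contMDiff_iff.1 hf).2 n n'
  refine h.contDiffAt (IsOpen.mem_nhds ?_ ⟨hz, hz'⟩)
  exact (continuousOn_extChartAt_symm n).isOpen_inter_preimage (isOpen_extChartAt_target n)
    ((isOpen_extChartAt_source n').preimage hf.continuous)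

theorem ContMDiff.eventually_contDiffAt_chart {f : M → N} (hf : ContMDiff (𝓡 d) (𝓡 d') ∞ f) (n : M) :
    ∀ᶠ z in 𝓝 (extChartAt (𝓡 d) n n), ContDiffAt ℝ ∞ (writtenInExtChartAt (𝓡 d) (𝓡 d') n f) z := by
  have h1 : ∀ᶠ z in 𝓝 (extChartAt (𝓡 d) n n), f ((extChartAt (𝓡 d) n).symm z) ∈
      (extChartAt (𝓡 d') (f n)).source := by
    have : Filter.Tendsto (fun z => f ((extChartAt (𝓡 d) n).symm z)) (𝓝 (extChartAt (𝓡 d) n n))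
        (𝓝 (f n)) := by
      have := (hf.continuous.continuousAt (x := n)).tendsto.comp
        (g := f) (f := (extChartAt (𝓡 d) n).symm) (x := 𝓝 (extChartAt (𝓡 d) n n)) (by
          simpa using (continuousAt_extChartAt_symm (I := 𝓡 d) n).tendsto)
      exact this
    exact this ((isOpen_extChartAt_source (f n)).mem_nhds (mem_extChartAt_source _))
  filter_upwards [h1, extChartAt_target_mem_nhds (I := 𝓡 d) n] with z hz hz2
  exact hf.contDiffAt_chart n (f n) hz2 hz

omit [IsManifold (𝓡 d) ∞ M] [IsManifold (𝓡 d') ∞ N] in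
theorem ContMDiff.fderiv_writtenInExtChartAt {f : M → N} (hf : ContMDiff (𝓡 d) (𝓡 d') ∞ f) (n : M) :
    fderiv ℝ (writtenInExtChartAt (𝓡 d) (𝓡 d') n f) (extChartAt (𝓡 d) n n) =
      mfderiv (𝓡 d) (𝓡 d') f n := by
  rw [(hf.mdifferentiable (by simp) n).mfderiv]
  simp [fderivWithin_univ]

end ChartExpression

/-! ### Deforming the unit section along the source fibres -/

section Family

variable {dM dG : ℕ} {M G : Type*}
  [TopologicalSpace M] [ChartedSpace (EuclideanSpace ℝ (Fin dM)) M] [IsManifold (𝓡 dM) ∞ M]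
  [TopologicalSpace G] [ChartedSpace (EuclideanSpace ℝ (Fin dG)) G] [IsManifold (𝓡 dG) ∞ G]

/-- If the source fibres have positive dimension, then the unit section can be deformed, near any
object, through a smooth family of local sections of the source map. -/
theorem LieGroupoid.exists_section_family (𝒢 : LieGroupoid dM dG M G) (hd : dM < dG) (n : M) :
    ∃ (γ : ℝ × EuclideanSpace ℝ (Fin dM) → EuclideanSpace ℝ (Fin dG)) (δ r : ℝ), 0 < δ ∧ 0 < r ∧
      (∀ z ∈ Metric.ball (0 : ℝ) δ ×ˢ Metric.ball (extChartAt (𝓡 dM) n n) r,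
        ContDiffAt ℝ ∞ γ z ∧ z.2 ∈ (extChartAt (𝓡 dM) n).target ∧
        γ z ∈ (extChartAt (𝓡 dG) (𝒢.ident n)).target ∧
        𝒢.s ((extChartAt (𝓡 dG) (𝒢.ident n)).symm (γ z)) = (extChartAt (𝓡 dM) n).symm z.2 ∧
        𝒢.t ((extChartAt (𝓡 dG) (𝒢.ident n)).symm (γ z)) ∈ (extChartAt (𝓡 dM) n).source ∧
        𝒢.ident ((extChartAt (𝓡 dM) n).symm z.2) ∈ (extChartAt (𝓡 dG) (𝒢.ident n)).source ∧
        γ (0, z.2) = extChartAt (𝓡 dG) (𝒢.ident n) (𝒢.ident ((extChartAt (𝓡 dM) n).symm z.2))) ∧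
      fderiv ℝ γ (0, extChartAt (𝓡 dM) n n) (1, 0) ≠ 0 := by
  set φ := extChartAt (𝓡 dM) n with hφ
  set ψ := extChartAt (𝓡 dG) (𝒢.ident n) with hψ
  set f := writtenInExtChartAt (𝓡 dG) (𝓡 dM) (𝒢.ident n) 𝒢.s with hfdef
  set i := writtenInExtChartAt (𝓡 dM) (𝓡 dG) n 𝒢.ident with hidef
  have hf : ∀ z, f z = φ (𝒢.s (ψ.symm z)) := fun z => by
    simp only [hfdef, writtenInExtChartAt, Function.comp_apply, 𝒢.s_ident]; rfl
  have hi : ∀ x, i x = ψ (𝒢.ident (φ.symm x)) := fun x => rfl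
  have hx0 : φ.symm (φ n) = n := extChartAt_to_inv n
  have hi0 : i (φ n) = ψ (𝒢.ident n) := by rw [hi, hx0]
  have hf0 : f (ψ (𝒢.ident n)) = φ n := by
    rw [hf, extChartAt_to_inv, 𝒢.s_ident]
  have hfs := 𝒢.smooth_s.eventually_contDiffAt_chart (𝒢.ident n)
  have his := 𝒢.smooth_ident.eventually_contDiffAt_chart n
  have hfd := 𝒢.smooth_s.fderiv_writtenInExtChartAt (𝒢.ident n)
  rw [← hfdef, ← hψ] at hfs hfd
  rw [← hidef, ← hφ] at his
  have hsurj : Function.Surjective (fderiv ℝ f (ψ (𝒢.ident n))) := by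
    rw [hfd]; exact 𝒢.submersion_s _
  -- The dimension hypothesis enters here: the derivative of the source map cannot be injective.
  obtain ⟨v, hv, hv0⟩ : ∃ v, fderiv ℝ f (ψ (𝒢.ident n)) v = 0 ∧ v ≠ 0 := by
    by_contra! hcon
    have hinj : Function.Injective (fderiv ℝ f (ψ (𝒢.ident n))).toLinearMap :=
      (injective_iff_map_eq_zero _).2 hcon
    have := LinearMap.finrank_le_finrank_of_injective hinj
    simp at this
    omega
  obtain ⟨Λ, hΛs, hΛ1, hΛ2⟩ := exists_fibre_retraction hfs hsurj
  have hκc : ContinuousAt (fun z : ℝ × EuclideanSpace ℝ (Fin dM) => (z.2, i z.2 + z.1 • v))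
      (0, φ n) := by
    have h1 : ContinuousAt (fun z : ℝ × EuclideanSpace ℝ (Fin dM) => i z.2) (0, φ n) :=
      ContinuousAt.comp (g := i) (f := Prod.snd) his.self_of_nhds.continuousAt continuousAt_snd
    exact continuousAt_snd.prodMk (h1.add (continuousAt_fst.smul continuousAt_const))
  have hκ : Filter.Tendsto (fun z : ℝ × EuclideanSpace ℝ (Fin dM) => (z.2, i z.2 + z.1 • v))
      (𝓝 (0, φ n)) (𝓝 (f (ψ (𝒢.ident n)), ψ (𝒢.ident n))) := by
    have := hκc.tendsto
    simpa only [hi0, zero_smul, add_zero, hf0] using this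
  have hsnd : Filter.Tendsto (Prod.snd : ℝ × EuclideanSpace ℝ (Fin dM) → _) (𝓝 (0, φ n))
      (𝓝 (φ n)) := continuousAt_snd
  -- Push the unit at `x` in the direction `v`, then retract onto the source fibre over `x`, so that
  -- `γ (ε, ·)` stays a section.
  set γ : ℝ × EuclideanSpace ℝ (Fin dM) → EuclideanSpace ℝ (Fin dG) :=
    fun z => Λ (z.2, i z.2 + z.1 • v) with hγ
  have hsmooth : ∀ᶠ z in 𝓝 ((0 : ℝ), φ n), ContDiffAt ℝ ∞ γ z := by
    filter_upwards [hκ.eventually hΛs, hsnd.eventually his] with z h1 h2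
    refine ContDiffAt.comp z (g := Λ) (f := fun z => (z.2, i z.2 + z.1 • v)) h1 ?_
    exact contDiffAt_snd.prodMk ((ContDiffAt.comp z (g := i) h2 contDiffAt_snd).add
      (contDiffAt_fst.smul contDiffAt_const))
  have hγ0 : γ (0, φ n) = ψ (𝒢.ident n) := by
    simp only [hγ, zero_smul, add_zero, hi0]
    have := hΛ2.self_of_nhds
    rwa [hf0] at this
  have hγc : Filter.Tendsto γ (𝓝 (0, φ n)) (𝓝 (ψ (𝒢.ident n))) := by
    rw [← hγ0]; exact hsmooth.self_of_nhds.continuousAt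
  have hψsymm : Filter.Tendsto ψ.symm (𝓝 (ψ (𝒢.ident n))) (𝓝 (𝒢.ident n)) := by
    have := (continuousAt_extChartAt_symm (I := 𝓡 dG) (𝒢.ident n)).tendsto
    rwa [extChartAt_to_inv] at this
  have hφsymm : Filter.Tendsto φ.symm (𝓝 (φ n)) (𝓝 n) := by
    have := (continuousAt_extChartAt_symm (I := 𝓡 dM) n).tendsto
    rwa [extChartAt_to_inv] at this
  have hφn : φ.source ∈ 𝓝 n := extChartAt_source_mem_nhds n
  have hit : Filter.Tendsto (fun x => 𝒢.ident (φ.symm x)) (𝓝 (φ n)) (𝓝 (𝒢.ident n)) :=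
    (𝒢.smooth_ident.continuous.tendsto n).comp hφsymm
  have hids : ∀ᶠ x in 𝓝 (φ n), 𝒢.ident (φ.symm x) ∈ ψ.source :=
    hit (extChartAt_source_mem_nhds (I := 𝓡 dG) (𝒢.ident n))
  have htt : Filter.Tendsto (fun z => 𝒢.t (ψ.symm (γ z))) (𝓝 (0, φ n)) (𝓝 n) := by
    have := (𝒢.smooth_t.continuous.tendsto (𝒢.ident n)).comp (hψsymm.comp hγc)
    rwa [𝒢.t_ident] at this
  have hst : Filter.Tendsto (fun z => 𝒢.s (ψ.symm (γ z))) (𝓝 (0, φ n)) (𝓝 n) := by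
    have := (𝒢.smooth_s.continuous.tendsto (𝒢.ident n)).comp (hψsymm.comp hγc)
    rwa [𝒢.s_ident] at this
  have htarget : ∀ᶠ x in 𝓝 (φ n), x ∈ φ.target := extChartAt_target_mem_nhds (I := 𝓡 dM) n
  have hi2 : Filter.Tendsto i (𝓝 (φ n)) (𝓝 (ψ (𝒢.ident n))) := by
    rw [← hi0]; exact his.self_of_nhds.continuousAt
  have hbase : ∀ᶠ x in 𝓝 (φ n), γ (0, x) = ψ (𝒢.ident (φ.symm x)) := by
    filter_upwards [hi2.eventually hΛ2, hids, htarget] with x h1 h2 h3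
    have h4 : f (i x) = x := by
      rw [hf, hi, ψ.left_inv h2, 𝒢.s_ident, φ.right_inv h3]
    simp only [hγ, zero_smul, add_zero]
    rw [h4] at h1
    exact h1
  have hall := hsmooth.and ((hsnd.eventually htarget).and ((hγc.eventually
    (extChartAt_target_mem_nhds (I := 𝓡 dG) (𝒢.ident n))).and ((hκ.eventually hΛ1).and
    ((hst.eventually hφn).and ((htt.eventually hφn).and ((hsnd.eventually hids).and
    (hsnd.eventually hbase)))))))
  obtain ⟨ε, hε, hball⟩ := Metric.eventually_nhds_iff_ball.1 hall
  refine ⟨γ, ε, ε, hε, hε, fun z hz => ?_, ?_⟩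
  · rw [ball_prod_same] at hz
    obtain ⟨h1, h2, h3, h4, h5, h6, h7, h8⟩ := hball z hz
    refine ⟨h1, h2, h3, ?_, h6, h7, h8⟩
    change f (γ z) = z.2 at h4
    rw [hf] at h4
    rw [← h4, φ.left_inv h5]
  · have hΛd : HasFDerivAt Λ (fderiv ℝ Λ (f (ψ (𝒢.ident n)), ψ (𝒢.ident n)))
        (f (ψ (𝒢.ident n)), ψ (𝒢.ident n)) :=
      (hΛs.self_of_nhds.differentiableAt (by simp)).hasFDerivAt
    rw [hf0] at hΛd
    -- Since `v` is tangent to the source fibre, the retraction does not change it to first order;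
    -- the `ε`-derivative of `γ` is therefore `v ≠ 0`.
    have hvert := fibre_retraction_deriv (hfs.self_of_nhds.differentiableAt (by simp)) (by rwa [hf0]) hΛ2 hv
    have hγd : HasFDerivAt γ (fderiv ℝ γ (0, φ n)) (0, φ n) :=
      (hsmooth.self_of_nhds.differentiableAt (by simp)).hasFDerivAt
    have hline : HasDerivAt (fun ε : ℝ => (ε, φ n)) ((1 : ℝ), (0 : EuclideanSpace ℝ (Fin dM))) 0 :=
      (hasDerivAt_id 0).prodMk (hasDerivAt_const 0 (φ n))
    have h1 := HasFDerivAt.comp_hasDerivAt (0 : ℝ) (f := fun ε : ℝ => (ε, φ n)) hγd hline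
    have hline2 : HasDerivAt (fun ε : ℝ => (φ n, i (φ n) + ε • v))
        ((0 : EuclideanSpace ℝ (Fin dM)), v) 0 := by
      have := (hasDerivAt_const (0 : ℝ) (φ n)).prodMk
        (((hasDerivAt_id (0 : ℝ)).smul_const v).const_add (i (φ n)))
      simpa using this
    have h2 : HasDerivAt (fun ε : ℝ => Λ (φ n, i (φ n) + ε • v)) _ 0 :=
      HasFDerivAt.comp_hasDerivAt (0 : ℝ) (f := fun ε : ℝ => (φ n, i (φ n) + ε • v))
        (by simpa only [zero_smul, add_zero, hi0] using hΛd) hline2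
    rw [h1.unique h2, hvert]
    exact hv0

end Family

/-! ### Global bisections that separate points and tangent vectors -/

section BumpBisection

variable {dM dG : ℕ} {M G : Type*}
  [TopologicalSpace M] [ChartedSpace (EuclideanSpace ℝ (Fin dM)) M] [IsManifold (𝓡 dM) ∞ M]
  [T2Space M]
  [TopologicalSpace G] [ChartedSpace (EuclideanSpace ℝ (Fin dG)) G] [IsManifold (𝓡 dG) ∞ G]

/-- If the source fibres have positive dimension, then the unit bisection can be deformed, inside a
chart, along every bump function. -/
theorem LieGroupoid.exists_bump_bisections (𝒢 : LieGroupoid dM dG M G) (hd : dM < dG) (n : M) :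
    ∃ (γ : ℝ × EuclideanSpace ℝ (Fin dM) → EuclideanSpace ℝ (Fin dG)) (r : ℝ), 0 < r ∧
      ContDiffAt ℝ ∞ γ (0, extChartAt (𝓡 dM) n n) ∧
      fderiv ℝ γ (0, extChartAt (𝓡 dM) n n) (1, 0) ≠ 0 ∧
      ∀ χ : EuclideanSpace ℝ (Fin dM) → ℝ, ContDiff ℝ ∞ χ →
        tsupport χ ⊆ Metric.ball (extChartAt (𝓡 dM) n n) r →
        ∀ᶠ ε in 𝓝 (0 : ℝ), ∃ β : Bisection 𝒢,
          (∀ x ∈ Metric.ball (extChartAt (𝓡 dM) n n) r,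
            extChartAt (𝓡 dG) (𝒢.ident n) (β ((extChartAt (𝓡 dM) n).symm x)) = γ (ε * χ x, x) ∧
            extChartAt (𝓡 dG) (𝒢.ident n) (𝒢.ident ((extChartAt (𝓡 dM) n).symm x)) = γ (0, x)) ∧
          ∀ y, (y ∈ (extChartAt (𝓡 dM) n).source → χ (extChartAt (𝓡 dM) n y) = 0) →
            β y = 𝒢.ident y := by
  obtain ⟨γ, δ, r, hδ, hr, hγ, hγ'⟩ := 𝒢.exists_section_family hd n
  set φ := extChartAt (𝓡 dM) n with hφ
  set ψ := extChartAt (𝓡 dG) (𝒢.ident n) with hψ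
  classical
  refine ⟨γ, r, hr, (hγ (0, φ n) ⟨Metric.mem_ball_self hδ, Metric.mem_ball_self hr⟩).1, hγ', ?_⟩
  intro χ hχ hsupp
  have hsub : Metric.ball (φ n) r ⊆ φ.target := fun x hx =>
    (hγ (0, x) ⟨Metric.mem_ball_self hδ, hx⟩).2.1
  have hunit : ∀ x ∈ Metric.ball (φ n) r, ψ.symm (γ (0, x)) = 𝒢.ident (φ.symm x) := by
    intro x hx
    obtain ⟨-, -, -, -, -, h1, h2⟩ := hγ (0, x) ⟨Metric.mem_ball_self hδ, hx⟩
    rw [h2, ψ.left_inv h1]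
  have hF : ContDiffOn ℝ ∞ (fun z => φ (𝒢.t (ψ.symm (γ z))))
      (Metric.ball (0 : ℝ) δ ×ˢ Metric.ball (φ n) r) := by
    intro z hz
    obtain ⟨h1, -, h3, -, h5, -⟩ := hγ z hz
    exact (ContDiffAt.comp z (g := fun w => φ (𝒢.t (ψ.symm w)))
      (𝒢.smooth_t.contDiffAt_chart (𝒢.ident n) n h3 h5) h1).contDiffWithinAt
  have hF0 : ∀ x ∈ Metric.ball (φ n) r, φ (𝒢.t (ψ.symm (γ (0, x)))) = x := by
    intro x hx
    rw [hunit x hx, 𝒢.t_ident, φ.right_inv (hsub hx)]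
  have hK : IsCompact (tsupport χ) :=
    Metric.isCompact_of_isClosed_isBounded (isClosed_tsupport χ) (Metric.isBounded_ball.subset hsupp)
  filter_upwards [eventually_exists_diffeo hF hδ hF0 hχ hsupp] with ε ⟨hε, Ψ, hΨ1, hΨ2, hΨ3, hΨ4⟩
  -- `Ψ` is the chart expression of `t ∘ b` for the section `b` defined next, so `S` will be its
  -- shadow.
  obtain ⟨S, hS⟩ := exists_diffeomorph_chartExtend n Ψ hΨ1 hΨ2 hK (hsupp.trans hsub) hΨ4
  let b : M → G := fun y => if y ∈ φ.source ∧ φ y ∈ Metric.ball (φ n) r then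
    ψ.symm (γ (ε * χ (φ y), φ y)) else 𝒢.ident y
  have hb : ∀ y ∈ φ.source, φ y ∈ Metric.ball (φ n) r → b y = ψ.symm (γ (ε * χ (φ y), φ y)) :=
    fun y h1 h2 => if_pos ⟨h1, h2⟩
  have hb' : ∀ y, (y ∈ φ.source → χ (φ y) = 0) → b y = 𝒢.ident y := by
    intro y hy
    by_cases h : y ∈ φ.source ∧ φ y ∈ Metric.ball (φ n) r
    · rw [hb y h.1 h.2, hy h.1, mul_zero, hunit _ h.2, φ.left_inv h.1]
    · exact if_neg h
  have hbs : ContMDiff (𝓡 dM) (𝓡 dG) ∞ b := by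
    refine contMDiff_of_eq_off_compact n hK (hsupp.trans hsub) 𝒢.smooth_ident (fun y h1 h2 => ?_)
      (fun y hy => hb' y fun h => image_eq_zero_of_notMem_tsupport (hy h))
    have h2' := hsupp h2
    obtain ⟨g1, -, g3, -⟩ := hγ (ε * χ (φ y), φ y) ⟨hε _, h2'⟩
    have e1 : ContMDiffAt (𝓡 dM) 𝓘(ℝ, EuclideanSpace ℝ (Fin dM)) ∞ φ y :=
      contMDiffAt_extChartAt' (by simpa using h1)
    have e2 : ContMDiffAt (𝓡 dM) 𝓘(ℝ, ℝ × EuclideanSpace ℝ (Fin dM)) ∞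
        (fun y => (ε * χ (φ y), φ y)) y :=
      ContMDiffAt.comp y (g := fun x => (ε * χ x, x)) (f := φ)
        ((contDiff_const.mul hχ).prodMk contDiff_id).contMDiff.contMDiffAt e1
    have e3 : ContMDiffAt (𝓡 dM) 𝓘(ℝ, EuclideanSpace ℝ (Fin dG)) ∞
        (fun y => γ (ε * χ (φ y), φ y)) y :=
      ContMDiffAt.comp y (g := γ) (f := fun y => (ε * χ (φ y), φ y)) g1.contMDiffAt e2
    have e4 : ContMDiffAt 𝓘(ℝ, EuclideanSpace ℝ (Fin dG)) (𝓡 dG) ∞ ψ.symm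
        (γ (ε * χ (φ y), φ y)) :=
      (contMDiffOn_extChartAt_symm _).contMDiffAt ((isOpen_extChartAt_target _).mem_nhds g3)
    have e5 := ContMDiffAt.comp y (g := ψ.symm) (f := fun y => γ (ε * χ (φ y), φ y)) e4 e3
    refine e5.congr_of_eventuallyEq ?_
    have : ContinuousAt φ y := e1.continuousAt
    filter_upwards [(isOpen_extChartAt_source n).mem_nhds h1,
      this (Metric.isOpen_ball.mem_nhds h2')] with w hw1 hw2
    exact hb w hw1 hw2
  have hsb : ∀ y, 𝒢.s (b y) = y := by
    intro y
    by_cases h : y ∈ φ.source ∧ φ y ∈ Metric.ball (φ n) r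
    · rw [hb y h.1 h.2]
      obtain ⟨-, -, -, g4, -⟩ := hγ (ε * χ (φ y), φ y) ⟨hε _, h.2⟩
      rw [g4, φ.left_inv h.1]
    · rw [show b y = 𝒢.ident y from if_neg h, 𝒢.s_ident]
  have htb : ∀ y, S y = 𝒢.t (b y) := by
    intro y
    rw [hS]
    by_cases h1 : y ∈ φ.source
    · rw [chartExtend_of_mem h1]
      by_cases h2 : φ y ∈ Metric.ball (φ n) r
      · obtain ⟨-, -, -, -, g5, -⟩ := hγ (ε * χ (φ y), φ y) ⟨hε _, h2⟩
        rw [hb y h1 h2, ← hφ, hΨ3 _ h2, φ.left_inv g5]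
      · rw [show b y = 𝒢.ident y from if_neg fun h => h2 h.2, 𝒢.t_ident,
          hΨ4 _ (fun h => h2 (hsupp h)), ← hφ, φ.left_inv h1]
    · rw [chartExtend_of_notMem h1, show b y = 𝒢.ident y from if_neg fun h => h1 h.1, 𝒢.t_ident]
  refine ⟨⟨b, hbs, hsb, S, htb⟩, fun x hx => ?_, hb'⟩
  obtain ⟨-, -, -, -, -, -, h2⟩ := hγ (0, x) ⟨Metric.mem_ball_self hδ, hx⟩
  refine ⟨?_, h2.symm⟩
  have h3 : φ (φ.symm x) = x := φ.right_inv (hsub hx)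
  have h4 : b (φ.symm x) = ψ.symm (γ (ε * χ x, x)) := by
    rw [hb _ (φ.map_target (hsub hx)) (by rwa [h3]), h3]
  change ψ (b (φ.symm x)) = _
  rw [h4, ψ.right_inv (hγ (ε * χ x, x) ⟨hε _, hx⟩).2.2.1]

/-- Bisections separate a unit from the units at other points. -/
theorem LieGroupoid.exists_bisection_ne (𝒢 : LieGroupoid dM dG M G) (hd : dM < dG) {m n : M}
    (hmn : m ≠ n) : ∃ β : Bisection 𝒢, β m = 𝒢.ident m ∧ β n ≠ 𝒢.ident n := by
  obtain ⟨γ, r, hr, hγ, hγ', H⟩ := 𝒢.exists_bump_bisections hd n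
  set φ := extChartAt (𝓡 dM) n with hφ
  -- The outer radius of the bump is chosen so that it vanishes at `m`, if `m` lies in the chart
  -- domain at all.
  obtain ⟨r', hr', hr'r, hm⟩ : ∃ r', 0 < r' ∧ r' < r ∧ (m ∈ φ.source → r' ≤ dist (φ m) (φ n)) := by
    by_cases h : m ∈ φ.source
    · have : 0 < dist (φ m) (φ n) := dist_pos.2 fun h' =>
        hmn (φ.injOn h (mem_extChartAt_source n) h')
      exact ⟨min (r / 2) (dist (φ m) (φ n)), by positivity,
        (min_le_left _ _).trans_lt (by linarith), fun _ => min_le_right _ _⟩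
    · exact ⟨r / 2, by positivity, by linarith, fun h' => absurd h' h⟩
  let χ : ContDiffBump (φ n) := ⟨r' / 2, r', by positivity, by linarith⟩
  have hline : HasDerivAt (fun ε : ℝ => γ (ε, φ n)) (fderiv ℝ γ (0, φ n) (1, 0)) 0 :=
    HasFDerivAt.comp_hasDerivAt (0 : ℝ) (f := fun ε : ℝ => (ε, φ n))
      (hγ.differentiableAt (by simp)).hasFDerivAt
      ((hasDerivAt_id 0).prodMk (hasDerivAt_const 0 (φ n)))
  -- A nonzero velocity forces the curve `ε ↦ γ (ε, φ n)` to leave its starting point for all small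
  -- `ε ≠ 0`.
  have hne := hline.eventually_ne (c := γ (0, φ n)) hγ'
  have hev := H χ χ.contDiff (by
    rw [χ.tsupport_eq]; exact Metric.closedBall_subset_ball hr'r)
  obtain ⟨ε, h1, β, h2, h3⟩ := (hne.and (hev.filter_mono nhdsWithin_le_nhds)).exists
  refine ⟨β, h3 m fun h => χ.zero_of_le_dist (hm h), fun h => h1 ?_⟩
  obtain ⟨h4, h5⟩ := h2 (φ n) (Metric.mem_ball_self hr)
  have hx0 : φ.symm (φ n) = n := extChartAt_to_inv n
  rw [hx0] at h4 h5
  have hχ1 : χ (φ n) = 1 := χ.one_of_mem_closedBall (Metric.mem_closedBall_self χ.rIn_pos.le)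
  rw [h, h5, hχ1, mul_one] at h4
  exact h4.symm

/-- Bisections through a unit separate tangent vectors from the unit section. -/
theorem LieGroupoid.exists_bisection_mfderiv_ne (𝒢 : LieGroupoid dM dG M G) (hd : dM < dG) (n : M)
    (a : TangentSpace (𝓡 dM) n) (ha : a ≠ 0) :
    ∃ β : Bisection 𝒢, β n = 𝒢.ident n ∧
      (mfderiv (𝓡 dM) (𝓡 dG) β n a : EuclideanSpace ℝ (Fin dG)) ≠
        mfderiv (𝓡 dM) (𝓡 dG) 𝒢.ident n a := by
  obtain ⟨γ, r, hr, hγ, hγ', H⟩ := 𝒢.exists_bump_bisections hd n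
  set φ := extChartAt (𝓡 dM) n with hφ
  change EuclideanSpace ℝ (Fin dM) at a
  let b : ContDiffBump (φ n) := ⟨r / 3, r / 2, by positivity, by linarith⟩
  -- Vanishing at `φ n` keeps the bisection trivial at `n`. The derivative `⟨a, ·⟩` there adds `ε
  -- ⟨a, a⟩` times the nonzero velocity of `γ` to the derivative on `a`.
  let χ : EuclideanSpace ℝ (Fin dM) → ℝ := fun x => b x * inner ℝ a (x - φ n)
  have hχ : ContDiff ℝ ∞ χ := b.contDiff.mul (contDiff_const.inner ℝ (contDiff_id.sub contDiff_const))
  have hsupp : tsupport χ ⊆ Metric.ball (φ n) r := by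
    refine (tsupport_mul_subset_left (f := b)).trans ?_
    rw [b.tsupport_eq]
    exact Metric.closedBall_subset_ball (by change r / 2 < r; linarith)
  have hχ0 : χ (φ n) = 0 := by simp [χ]
  have hχd : HasFDerivAt χ (innerSL ℝ a) (φ n) := by
    have h1 : HasFDerivAt (fun x => inner ℝ a (x - φ n)) (innerSL ℝ a) (φ n) :=
      (innerSL ℝ a).hasFDerivAt.comp (φ n) ((hasFDerivAt_id (φ n)).sub_const (φ n))
    refine h1.congr_of_eventuallyEq ?_
    filter_upwards [b.eventuallyEq_one] with x hx
    simp only [χ, hx, Pi.one_apply, one_mul]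
  obtain ⟨ε, hε, β, h2, h3⟩ := ((eventually_mem_nhdsWithin (a := (0 : ℝ)) (s := {0}ᶜ)).and
    ((H χ hχ hsupp).filter_mono nhdsWithin_le_nhds)).exists
  have hβn : β n = 𝒢.ident n := h3 n fun _ => hχ0
  refine ⟨β, hβn, ?_⟩
  have hball := Metric.ball_mem_nhds (φ n) hr
  have hγd : HasFDerivAt γ (fderiv ℝ γ (0, φ n)) (0, φ n) :=
    (hγ.differentiableAt (by simp)).hasFDerivAt
  have hd1 : HasFDerivAt (fun x => γ (ε * χ x, x)) ((fderiv ℝ γ (0, φ n)).comp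
      ((ε • innerSL ℝ a).prod (.id ℝ _))) (φ n) :=
    HasFDerivAt.comp (φ n) (f := fun x => (ε * χ x, x)) (by rwa [hχ0, mul_zero])
      ((hχd.const_mul ε).prodMk (hasFDerivAt_id _))
  have hd2 : HasFDerivAt (fun x => γ (0, x)) ((fderiv ℝ γ (0, φ n)).comp
      ((0 : EuclideanSpace ℝ (Fin dM) →L[ℝ] ℝ).prod (.id ℝ _))) (φ n) :=
    HasFDerivAt.comp (φ n) (f := fun x => ((0 : ℝ), x)) hγd
      ((hasFDerivAt_const _ _).prodMk (hasFDerivAt_id _))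
  have e1 : mfderiv (𝓡 dM) (𝓡 dG) β n = (fderiv ℝ γ (0, φ n)).comp
      ((ε • innerSL ℝ a).prod (.id ℝ _)) := by
    rw [← β.smooth.fderiv_writtenInExtChartAt n, ← hd1.fderiv]
    refine Filter.EventuallyEq.fderiv_eq ?_
    filter_upwards [hball] with x hx
    simp only [writtenInExtChartAt, hβn, Function.comp_apply]
    exact (h2 x hx).1
  have e2 : mfderiv (𝓡 dM) (𝓡 dG) 𝒢.ident n = (fderiv ℝ γ (0, φ n)).comp
      ((0 : EuclideanSpace ℝ (Fin dM) →L[ℝ] ℝ).prod (.id ℝ _)) := by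
    rw [← 𝒢.smooth_ident.fderiv_writtenInExtChartAt n, ← hd2.fderiv]
    refine Filter.EventuallyEq.fderiv_eq ?_
    filter_upwards [hball] with x hx
    exact (h2 x hx).2
  intro h
  have h' : fderiv ℝ γ (0, φ n) (ε * inner ℝ a a, a) = fderiv ℝ γ (0, φ n) (0, a) := by
    have f1 := congrArg (fun L => L a) e1
    have f2 := congrArg (fun L => L a) e2
    exact f1.symm.trans (h.trans f2)
  rw [← sub_eq_zero, ← map_sub] at h'
  have h6 : ((ε * inner ℝ a a, a) - (0, a) : ℝ × EuclideanSpace ℝ (Fin dM)) =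
      (ε * inner ℝ a a) • (1, 0) := by
    ext <;> simp
  rw [h6, map_smul, smul_eq_zero] at h'
  rcases h' with h' | h'
  · rcases mul_eq_zero.1 h' with h' | h'
    · exact hε h'
    · exact ha (inner_self_eq_zero.1 h')
  · exact hγ' h'

end BumpBisection

/-! ### Translations by bisections and the maps commuting with them -/

section Translations

variable {dM dG : ℕ} {M G : Type*}
  [TopologicalSpace M] [ChartedSpace (EuclideanSpace ℝ (Fin dM)) M]
  [TopologicalSpace G] [ChartedSpace (EuclideanSpace ℝ (Fin dG)) G]
  {𝒢 : LieGroupoid dM dG M G}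

namespace Bisection

theorem t_shadow_symm (β : Bisection 𝒢) (m : M) : 𝒢.t (β (β.shadow.symm m)) = m := by
  rw [← β.shadow_apply, Diffeomorph.apply_symm_apply]

theorem shadow_symm_t (β : Bisection 𝒢) (m : M) : β.shadow.symm (𝒢.t (β m)) = m := by
  rw [← β.shadow_apply, Diffeomorph.symm_apply_apply]

theorem s_R (β : Bisection 𝒢) (g : G) : 𝒢.s (β.R g) = β.shadow.symm (𝒢.s g) := by
  rw [R, 𝒢.s_mul _ _ (β.t_shadow_symm _).symm, β.s_toFun]

theorem t_R (β : Bisection 𝒢) (g : G) : 𝒢.t (β.R g) = 𝒢.t g :=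
  𝒢.t_mul _ _ (β.t_shadow_symm _).symm

theorem R_one (g : G) : (1 : Bisection 𝒢).R g = g := 𝒢.mul_ident g

theorem R_mul (β₁ β₂ : Bisection 𝒢) (g : G) : (β₁ * β₂).R g = β₂.R (β₁.R g) := by
  have h : 𝒢.t (β₂ (β₂.shadow.symm (β₁.shadow.symm (𝒢.s g)))) = β₁.shadow.symm (𝒢.s g) :=
    β₂.t_shadow_symm _
  have e : (β₁ * β₂).R g = 𝒢.mul g (𝒢.mul
      (β₁ (𝒢.t (β₂ (β₂.shadow.symm (β₁.shadow.symm (𝒢.s g))))))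
      (β₂ (β₂.shadow.symm (β₁.shadow.symm (𝒢.s g))))) := rfl
  rw [e, h, ← 𝒢.mul_assoc _ _ _ (β₁.t_shadow_symm _).symm (by rw [β₁.s_toFun, h])]
  conv_rhs => rw [R, β₁.s_R]
  rfl

/-- This consequence of associativity makes a change of trivialisation in `L(𝔹)` compatible with the
right action of `𝔹`. -/
theorem L_R (β β' : Bisection 𝒢) (g : G) : β'.L (β.R g) = β.R (β'.L g) := by
  rw [R, R, s_L, L_mul _ _ _ (β.t_shadow_symm _).symm]

theorem smooth_R (β : Bisection 𝒢) : ContMDiff (𝓡 dG) (𝓡 dG) ∞ β.R := by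
  have h : ContMDiff (𝓡 dG) ((𝓡 dG).prod (𝓡 dG)) ∞
      (fun g => (g, β (β.shadow.symm (𝒢.s g)))) :=
    contMDiff_id.prodMk (β.smooth.comp (β.shadow.symm.contMDiff.comp 𝒢.smooth_s))
  exact 𝒢.smooth_mul.comp_contMDiff h fun g => (β.t_shadow_symm _).symm

/-- Under `Id`-reducibility this shows that every arrow is a right translate of the unit at its
target, so an equivariant map is known from its values on units. -/
theorem R_ident_t (β : Bisection 𝒢) {g : G} (h : β (𝒢.s g) = g) : β.R (𝒢.ident (𝒢.t g)) = g := by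
  have : β.shadow.symm (𝒢.t g) = 𝒢.s g := by
    conv_lhs => rw [← h]
    exact β.shadow_symm_t _
  rw [R, 𝒢.s_ident, this, h, 𝒢.ident_mul]

/-- If right translation by a bisection fixes an arrow, then the bisection is trivial at its
source. -/
theorem apply_eq_ident_of_R_eq (β : Bisection 𝒢) {g : G} (h : β.R g = g) :
    β (𝒢.s g) = 𝒢.ident (𝒢.s g) := by
  have h1 : β.shadow.symm (𝒢.s g) = 𝒢.s g := by rw [← s_R, h]
  have h2 : 𝒢.s g = 𝒢.t (β (𝒢.s g)) := by
    conv_lhs => rw [← β.t_shadow_symm (𝒢.s g), h1]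
  have h3 : 𝒢.mul g (β (𝒢.s g)) = g := by
    conv_rhs => rw [← h, R, h1]
  rw [← 𝒢.ident_mul (β (𝒢.s g)), ← h2, ← 𝒢.inv_mul,
    𝒢.mul_assoc _ _ _ (𝒢.s_inv g) h2, h3]

theorem R_ident_of_apply_eq (β : Bisection 𝒢) {g : G} (h : β (𝒢.s g) = 𝒢.ident (𝒢.s g)) :
    β.R g = g := by
  have h1 : β.shadow.symm (𝒢.s g) = 𝒢.s g := by
    conv_lhs => rw [← 𝒢.t_ident (𝒢.s g), ← h]
    exact β.shadow_symm_t _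
  rw [R, h1, h, 𝒢.mul_ident]

end Bisection

variable [IsManifold (𝓡 dM) ∞ M] [T2Space M] [IsManifold (𝓡 dG) ∞ G]

/-- A map commuting with right translations preserves the sources of units. -/
theorem LieGroupoid.s_apply_ident_of_commute (hdim : dM < dG ∨ Subsingleton M) {f : G → G}
    (hf : ∀ (β : Bisection 𝒢) g, f (β.R g) = β.R (f g)) (m : M) : 𝒢.s (f (𝒢.ident m)) = m := by
  rcases hdim with hd | h
  · by_contra hne
    -- `R_β` fixes the unit at `m`, hence also its image under `f`; then `β` would be trivial at the
    -- source of that image.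
    obtain ⟨β, h1, h2⟩ := 𝒢.exists_bisection_ne hd (Ne.symm hne)
    refine h2 (β.apply_eq_ident_of_R_eq ?_)
    rw [← hf, β.R_ident_of_apply_eq]
    rw [𝒢.s_ident, h1]
  · exact Subsingleton.elim _ _

/-- In an `Id`-reducible groupoid, the diffeomorphisms commuting with right translations are the
left translations. -/
theorem LieGroupoid.IsIdReducible.exists_L_eq (hred : 𝒢.IsIdReducible)
    (hdim : dM < dG ∨ Subsingleton M) {f f' : G → G} (hfs : ContMDiff (𝓡 dG) (𝓡 dG) ∞ f)
    (hfs' : ContMDiff (𝓡 dG) (𝓡 dG) ∞ f') (hff' : Function.LeftInverse f' f)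
    (hff : Function.LeftInverse f f')
    (hf : ∀ (β : Bisection 𝒢) g, f (β.R g) = β.R (f g)) :
    ∃ b : Bisection 𝒢, (∀ m, b m = f (𝒢.ident m)) ∧ ∀ g, f g = b.L g := by
  have hf' : ∀ (β : Bisection 𝒢) g, f' (β.R g) = β.R (f' g) := fun β g => by
    rw [← hff' (β.R (f' g)), hf, hff]
  have key : ∀ {f : G → G} (hf : ∀ (β : Bisection 𝒢) g, f (β.R g) = β.R (f g)) (g : G),
      f g = 𝒢.mul (f (𝒢.ident (𝒢.t g))) g := by
    intro f hf g
    obtain ⟨β, hβ⟩ := hred g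
    have h : β.shadow.symm (𝒢.t g) = 𝒢.s g := by
      conv_lhs => rw [← hβ]
      exact β.shadow_symm_t _
    conv_lhs => rw [← β.R_ident_t hβ, hf, Bisection.R,
      LieGroupoid.s_apply_ident_of_commute hdim hf, h, hβ]
  -- Applying `key` for `f'` to the arrow `f (ident m)` writes `ident m` as a product; comparing
  -- targets shows that the candidate shadows are mutually inverse.
  have hinv : ∀ {f f' : G → G} (_ : Function.LeftInverse f' f)
      (_ : ∀ (β : Bisection 𝒢) g, f (β.R g) = β.R (f g))
      (_ : ∀ (β : Bisection 𝒢) g, f' (β.R g) = β.R (f' g)) (m : M),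
      𝒢.t (f' (𝒢.ident (𝒢.t (f (𝒢.ident m))))) = m := by
    intro f f' h hf hf' m
    have h1 := key hf' (f (𝒢.ident m))
    rw [h] at h1
    have h2 := congrArg 𝒢.t h1
    rw [𝒢.t_ident, 𝒢.t_mul _ _ (LieGroupoid.s_apply_ident_of_commute hdim hf' _)] at h2
    exact h2.symm
  refine ⟨{ toFun := fun m => f (𝒢.ident m)
            smooth := hfs.comp 𝒢.smooth_ident
            s_toFun := LieGroupoid.s_apply_ident_of_commute hdim hf
            shadow :=
              { toFun := fun m => 𝒢.t (f (𝒢.ident m))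
                invFun := fun m => 𝒢.t (f' (𝒢.ident m))
                left_inv := hinv hff' hf hf'
                right_inv := hinv hff hf' hf
                contMDiff_toFun := 𝒢.smooth_t.comp (hfs.comp 𝒢.smooth_ident)
                contMDiff_invFun := 𝒢.smooth_t.comp (hfs'.comp 𝒢.smooth_ident) }
            shadow_apply := fun _ => rfl }, fun _ => rfl, key hf⟩

end Translations

/-! ### The correspondence between the two bundle structures -/

section Structures

variable {dM dG dX dP : ℕ} {M G X P : Type*}
  [TopologicalSpace M] [ChartedSpace (EuclideanSpace ℝ (Fin dM)) M]
  [TopologicalSpace G] [ChartedSpace (EuclideanSpace ℝ (Fin dG)) G]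
  [TopologicalSpace X] [ChartedSpace (EuclideanSpace ℝ (Fin dX)) X]
  [TopologicalSpace P] [ChartedSpace (EuclideanSpace ℝ (Fin dP)) P]
  {𝒢 : LieGroupoid dM dG M G} {π : P → X}

theorem IsSmoothTriv.contMDiffAt_fibre {τ : Bundle.Trivialization G π} (hτ : IsSmoothTriv dG dX dP τ)
    {p : P} (hp : p ∈ τ.source) : ContMDiffAt (𝓡 dP) (𝓡 dG) ∞ (fun q => (τ q).2) p :=
  contMDiffAt_snd.comp p (hτ.1.contMDiffAt (τ.open_source.mem_nhds hp))

theorem IsSmoothTriv.contMDiffAt_proj {τ : Bundle.Trivialization G π}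
    (hτ : IsSmoothTriv dG dX dP τ) {p : P} (hp : p ∈ τ.source) :
    ContMDiffAt (𝓡 dP) (𝓡 dX) ∞ π p := by
  refine ContMDiffAt.congr_of_eventuallyEq (contMDiffAt_fst.comp p
    (hτ.1.contMDiffAt (τ.open_source.mem_nhds hp))) ?_
  filter_upwards [τ.open_source.mem_nhds hp] with q hq
  exact (τ.coe_fst hq).symm

theorem IsSmoothTriv.contMDiffAt_symm {τ : Bundle.Trivialization G π}
    (hτ : IsSmoothTriv dG dX dP τ) {y : X × G} (hy : y.1 ∈ τ.baseSet) :
    ContMDiffAt ((𝓡 dX).prod (𝓡 dG)) (𝓡 dP) ∞ τ.toOpenPartialHomeomorph.symm y :=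
  hτ.2.contMDiffAt (τ.open_target.mem_nhds (τ.mem_target.2 hy))

omit [ChartedSpace (EuclideanSpace ℝ (Fin dG)) G] [ChartedSpace (EuclideanSpace ℝ (Fin dX)) X]
  [ChartedSpace (EuclideanSpace ℝ (Fin dP)) P] in
theorem Bundle.Trivialization.symm_proj_snd (τ : Bundle.Trivialization G π) {p : P} (hp : p ∈ τ.source) :
    τ.toOpenPartialHomeomorph.symm (π p, (τ p).2) = p := by
  rw [← τ.coe_fst hp]
  exact τ.toOpenPartialHomeomorph.left_inv hp

omit [ChartedSpace (EuclideanSpace ℝ (Fin dG)) G] [ChartedSpace (EuclideanSpace ℝ (Fin dX)) X]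
  [ChartedSpace (EuclideanSpace ℝ (Fin dP)) P] in
theorem Bundle.Trivialization.symm_mem_source (τ : Bundle.Trivialization G π) {σ : X} (hσ : σ ∈ τ.baseSet) (g : G) :
    τ.toOpenPartialHomeomorph.symm (σ, g) ∈ τ.source :=
  τ.toOpenPartialHomeomorph.map_target (τ.mem_target.2 hσ)

omit [ChartedSpace (EuclideanSpace ℝ (Fin dG)) G] [ChartedSpace (EuclideanSpace ℝ (Fin dX)) X]
  [ChartedSpace (EuclideanSpace ℝ (Fin dP)) P] in
theorem Bundle.Trivialization.eq_of_apply_snd_eq (τ : Bundle.Trivialization G π) {p q : P} (hp : p ∈ τ.source)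
    (h : π q = π p) (h' : (τ q).2 = (τ p).2) : q = p := by
  have hq : q ∈ τ.source := by rwa [τ.mem_source, h, ← τ.mem_source]
  rw [← τ.symm_proj_snd hp, ← τ.symm_proj_snd hq, h, h']

namespace PrincipaloidBundle

theorem ext_atlas {𝒜 𝒜' : PrincipaloidBundle dX dP 𝒢 π} (h : 𝒜.atlas = 𝒜'.atlas) : 𝒜 = 𝒜' := by
  cases 𝒜; cases 𝒜'; cases h; rfl

variable (𝒜 : PrincipaloidBundle dX dP 𝒢 π)

theorem mem_source_trivAt (p : P) : p ∈ (𝒜.trivAt (π p)).source :=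
  (𝒜.trivAt (π p)).mem_source.2 (𝒜.mem_trivAt _)

theorem contMDiff_moment : ContMDiff (𝓡 dP) (𝓡 dM) ∞ 𝒜.moment := by
  intro p
  have hp := 𝒜.mem_source_trivAt p
  refine ContMDiffAt.congr_of_eventuallyEq (𝒢.smooth_s.contMDiffAt.comp p
    ((𝒜.smooth _ (𝒜.trivAt_mem (π p))).contMDiffAt_fibre hp)) ?_
  filter_upwards [(𝒜.trivAt (π p)).open_source.mem_nhds hp] with q hq
  exact 𝒜.moment_eq (𝒜.trivAt_mem _) q ((𝒜.trivAt (π p)).mem_source.1 hq)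

/-- The right action of bisections induced by the groupoid action. -/
noncomputable def act (β : Bisection 𝒢) (p : P) : P :=
  𝒜.rho p (β (β.shadow.symm (𝒜.moment p)))

variable {𝒜} in
theorem act_eq {τ : Bundle.Trivialization G π} (hτ : τ ∈ 𝒜.atlas) (β : Bisection 𝒢) {p : P}
    (hp : p ∈ τ.source) :
    𝒜.act β p = τ.toOpenPartialHomeomorph.symm (π p, β.R (τ p).2) := by
  have hb := τ.mem_source.1 hp
  rw [act, 𝒜.rho_eq hτ p hb _ (β.t_shadow_symm _).symm, 𝒜.moment_eq hτ p hb]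
  rfl

variable {𝒜} in
theorem apply_act {τ : Bundle.Trivialization G π} (hτ : τ ∈ 𝒜.atlas) (β : Bisection 𝒢) {p : P}
    (hp : p ∈ τ.source) : τ (𝒜.act β p) = (π p, β.R (τ p).2) := by
  rw [𝒜.act_eq hτ β hp, τ.apply_symm_apply' (τ.mem_source.1 hp)]

theorem proj_act (β : Bisection 𝒢) (p : P) : π (𝒜.act β p) = π p := by
  rw [𝒜.act_eq (𝒜.trivAt_mem _) β (𝒜.mem_source_trivAt p)]
  exact (𝒜.trivAt (π p)).proj_symm_apply' (𝒜.mem_trivAt _)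

theorem contMDiff_act (β : Bisection 𝒢) : ContMDiff (𝓡 dP) (𝓡 dP) ∞ (𝒜.act β) := by
  intro p
  have hp := 𝒜.mem_source_trivAt p
  have hs := 𝒜.smooth _ (𝒜.trivAt_mem (π p))
  have h1 : ContMDiffAt (𝓡 dP) ((𝓡 dX).prod (𝓡 dG)) ∞
      (fun q => (π q, β.R ((𝒜.trivAt (π p)) q).2)) p :=
    (hs.contMDiffAt_proj hp).prodMk (β.smooth_R.contMDiffAt.comp p (hs.contMDiffAt_fibre hp))
  refine ContMDiffAt.congr_of_eventuallyEq
    (ContMDiffAt.comp p (f := fun q => (π q, β.R ((𝒜.trivAt (π p)) q).2))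
      (hs.contMDiffAt_symm (𝒜.mem_trivAt _)) h1) ?_
  filter_upwards [(𝒜.trivAt (π p)).open_source.mem_nhds hp] with q hq
  exact 𝒜.act_eq (𝒜.trivAt_mem _) β hq

/-- The `𝒢`-fibred `𝔹`-bundle underlying a principaloid bundle. -/
noncomputable def toGFibredBBundle : GFibredBBundle dX dP 𝒢 π where
  act := 𝒜.act
  act_one p := by
    have hp := 𝒜.mem_source_trivAt p
    refine (𝒜.trivAt (π p)).eq_of_apply_snd_eq hp (𝒜.proj_act _ _) ?_
    rw [𝒜.apply_act (𝒜.trivAt_mem _) _ hp, Bisection.R_one]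
  act_mul β₁ β₂ p := by
    have hp := 𝒜.mem_source_trivAt p
    have hp' : 𝒜.act β₁ p ∈ (𝒜.trivAt (π p)).source := by
      rw [Bundle.Trivialization.mem_source, 𝒜.proj_act]; exact 𝒜.mem_trivAt _
    refine (𝒜.trivAt (π p)).eq_of_apply_snd_eq ?_ ?_ ?_
    · rw [Bundle.Trivialization.mem_source, 𝒜.proj_act, 𝒜.proj_act]; exact 𝒜.mem_trivAt _
    · rw [𝒜.proj_act, 𝒜.proj_act, 𝒜.proj_act]
    · rw [𝒜.apply_act (𝒜.trivAt_mem _) _ hp, 𝒜.apply_act (𝒜.trivAt_mem _) _ hp',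
        𝒜.apply_act (𝒜.trivAt_mem _) _ hp, Bisection.R_mul]
  smooth_act := 𝒜.contMDiff_act
  proj_act := 𝒜.proj_act
  locally_trivial σ := ⟨𝒜.trivAt σ, 𝒜.mem_trivAt σ, 𝒜.smooth _ (𝒜.trivAt_mem σ),
    fun β _ hp => 𝒜.apply_act (𝒜.trivAt_mem σ) β hp⟩

end PrincipaloidBundle

namespace GFibredBBundle

theorem ext_act {𝒬 𝒬' : GFibredBBundle dX dP 𝒢 π} (h : 𝒬.act = 𝒬'.act) : 𝒬 = 𝒬' := by
  cases 𝒬; cases 𝒬'; cases h; rfl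

variable (𝒬 : GFibredBBundle dX dP 𝒢 π)

/-- The smooth local trivialisations that intertwine the action of bisections with right
multiplication. -/
def equivariantTrivs : Set (Bundle.Trivialization G π) :=
  {τ | IsSmoothTriv dG dX dP τ ∧ ∀ β, ∀ p ∈ τ.source, τ (𝒬.act β p) = (π p, β.R (τ p).2)}

variable {𝒬}

theorem act_symm {τ : Bundle.Trivialization G π} (hτ : τ ∈ 𝒬.equivariantTrivs) (β : Bisection 𝒢)
    {σ : X} (hσ : σ ∈ τ.baseSet) (g : G) :
    𝒬.act β (τ.toOpenPartialHomeomorph.symm (σ, g)) =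
      τ.toOpenPartialHomeomorph.symm (σ, β.R g) := by
  have hp := τ.symm_mem_source hσ g
  have hp' := τ.symm_mem_source hσ (β.R g)
  refine τ.eq_of_apply_snd_eq hp' ?_ ?_
  · rw [𝒬.proj_act, τ.proj_symm_apply' hσ, τ.proj_symm_apply' hσ]
  · rw [hτ.2 β _ hp, τ.apply_symm_apply' hσ, τ.apply_symm_apply' hσ]

/-- Both trivialisations turn one and the same action on `P` into `R_β`, so passing between them
commutes with `R_β`. -/
theorem transition_R {τ τ' : Bundle.Trivialization G π} (hτ : τ ∈ 𝒬.equivariantTrivs)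
    (hτ' : τ' ∈ 𝒬.equivariantTrivs) {σ : X} (hσ : σ ∈ τ.baseSet ∩ τ'.baseSet) (β : Bisection 𝒢)
    (g : G) : (τ (τ'.toOpenPartialHomeomorph.symm (σ, β.R g))).2 =
      β.R (τ (τ'.toOpenPartialHomeomorph.symm (σ, g))).2 := by
  rw [← act_symm hτ' β hσ.2, hτ.2]
  rw [τ.mem_source, τ'.proj_symm_apply' hσ.2]
  exact hσ.1

omit [ChartedSpace (EuclideanSpace ℝ (Fin dG)) G] in
theorem _root_.Bundle.Trivialization.transition_inv (τ τ' : Bundle.Trivialization G π) {σ : X}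
    (hσ : σ ∈ τ.baseSet ∩ τ'.baseSet) (g : G) : (τ' (τ.toOpenPartialHomeomorph.symm
      (σ, (τ (τ'.toOpenPartialHomeomorph.symm (σ, g))).2))).2 = g := by
  have h1 : τ'.toOpenPartialHomeomorph.symm (σ, g) ∈ τ.source := by
    rw [τ.mem_source, τ'.proj_symm_apply' hσ.2]; exact hσ.1
  have h2 := τ.symm_proj_snd h1
  rw [τ'.proj_symm_apply' hσ.2] at h2
  rw [h2, τ'.apply_symm_apply' hσ.2]

theorem _root_.IsSmoothTriv.contMDiffAt_transition {τ τ' : Bundle.Trivialization G π}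
    (hτ : IsSmoothTriv dG dX dP τ) (hτ' : IsSmoothTriv dG dX dP τ') {y : X × G}
    (hy : y.1 ∈ τ.baseSet ∩ τ'.baseSet) : ContMDiffAt ((𝓡 dX).prod (𝓡 dG)) (𝓡 dG) ∞
      (fun y => (τ (τ'.toOpenPartialHomeomorph.symm y)).2) y := by
  have h : τ'.toOpenPartialHomeomorph.symm y ∈ τ.source := by
    rw [τ.mem_source, τ'.proj_symm_apply (τ'.mem_target.2 hy.2)]; exact hy.1
  exact (hτ.contMDiffAt_fibre h).comp y (hτ'.contMDiffAt_symm hy.2)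

variable [IsManifold (𝓡 dM) ∞ M] [T2Space M] [IsManifold (𝓡 dG) ∞ G]

/-- Equivariant trivialisations differ by families of left translations. -/
theorem lCompatible (hred : 𝒢.IsIdReducible) (hdim : dM < dG ∨ Subsingleton M)
    {τ τ' : Bundle.Trivialization G π} (hτ : τ ∈ 𝒬.equivariantTrivs)
    (hτ' : τ' ∈ 𝒬.equivariantTrivs) : LCompatible dX 𝒢 τ τ' := by
  classical
  have hslice : ∀ {τ τ' : Bundle.Trivialization G π}, τ ∈ 𝒬.equivariantTrivs →
      τ' ∈ 𝒬.equivariantTrivs → ∀ σ ∈ τ.baseSet ∩ τ'.baseSet, ContMDiff (𝓡 dG) (𝓡 dG) ∞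
        fun g => (τ (τ'.toOpenPartialHomeomorph.symm (σ, g))).2 := by
    intro τ τ' hτ hτ' σ hσ g
    exact ContMDiffAt.comp g (f := fun g => (σ, g))
      (hτ.1.contMDiffAt_transition hτ'.1 (y := (σ, g)) hσ)
      (contMDiffAt_const.prodMk contMDiffAt_id)
  have hex : ∀ σ ∈ τ.baseSet ∩ τ'.baseSet, ∃ b : Bisection 𝒢,
      (∀ m, b m = (τ (τ'.toOpenPartialHomeomorph.symm (σ, 𝒢.ident m))).2) ∧
      ∀ g, (τ (τ'.toOpenPartialHomeomorph.symm (σ, g))).2 = b.L g := fun σ hσ =>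
    hred.exists_L_eq hdim (hslice hτ hτ' σ hσ) (hslice hτ' hτ σ hσ.symm)
      (τ.transition_inv τ' hσ) (τ'.transition_inv τ hσ.symm) (transition_R hτ hτ' hσ)
  -- Off the overlap the unit bisection is a dummy value; no condition is imposed there.
  let b : X → Bisection 𝒢 := fun σ =>
    if h : σ ∈ τ.baseSet ∩ τ'.baseSet then (hex σ h).choose else 1
  have hb : ∀ σ (h : σ ∈ τ.baseSet ∩ τ'.baseSet), b σ = (hex σ h).choose := fun σ h => dif_pos h
  refine ⟨b, ?_, fun σ hσ g => ?_⟩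
  -- Although the bisections are chosen pointwise, their values are those of the transition map on
  -- units, hence jointly smooth.
  · have h1 : ContMDiffOn ((𝓡 dX).prod (𝓡 dM)) (𝓡 dG) ∞
        (fun y : X × M => (τ (τ'.toOpenPartialHomeomorph.symm (y.1, 𝒢.ident y.2))).2)
        ((τ.baseSet ∩ τ'.baseSet) ×ˢ Set.univ) := by
      intro y hy
      refine ContMDiffAt.contMDiffWithinAt ?_
      exact ContMDiffAt.comp y (f := fun y : X × M => (y.1, 𝒢.ident y.2))
        (hτ.1.contMDiffAt_transition hτ'.1 (y := (y.1, 𝒢.ident y.2)) hy.1)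
        (contMDiffAt_fst.prodMk (𝒢.smooth_ident.contMDiffAt.comp y contMDiffAt_snd))
    refine h1.congr fun y hy => ?_
    rw [hb _ hy.1]
    exact (hex y.1 hy.1).choose_spec.1 y.2
  · have h : τ'.toOpenPartialHomeomorph.symm (σ, g) ∈ τ.source := by
      rw [τ.mem_source, τ'.proj_symm_apply' hσ.2]; exact hσ.1
    refine Prod.ext ?_ ?_
    · rw [τ.coe_fst h, τ'.proj_symm_apply' hσ.2]
    · rw [hb _ hσ]
      exact (hex σ hσ).choose_spec.2 g

omit [IsManifold (𝓡 dM) ∞ M] [T2Space M] [IsManifold (𝓡 dG) ∞ G] in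
-- Left translations commute with right ones, so equivariance passes from a nearby equivariant
-- trivialisation to `τ`. This gives maximality of the equivariant atlas.
theorem mem_equivariantTrivs_of_lCompatible {τ : Bundle.Trivialization G π}
    (hs : IsSmoothTriv dG dX dP τ) (h : ∀ τ' ∈ 𝒬.equivariantTrivs, LCompatible dX 𝒢 τ τ') :
    τ ∈ 𝒬.equivariantTrivs := by
  refine ⟨hs, fun β p hp => ?_⟩
  obtain ⟨τ', hσ, h1, h2⟩ := 𝒬.locally_trivial (π p)
  obtain ⟨b, -, hb⟩ := h τ' ⟨h1, h2⟩
  have hm : π p ∈ τ.baseSet ∩ τ'.baseSet := ⟨τ.mem_source.1 hp, hσ⟩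
  have hp' : p ∈ τ'.source := τ'.mem_source.2 hσ
  have e1 := hb (π p) hm (τ' p).2
  rw [τ'.symm_proj_snd hp'] at e1
  have e2 := hb (π p) hm (τ' (𝒬.act β p)).2
  have hact : 𝒬.act β p ∈ τ'.source := by rw [τ'.mem_source, 𝒬.proj_act]; exact hσ
  have e3 := τ'.symm_proj_snd hact
  rw [𝒬.proj_act] at e3
  rw [e3, h2 β p hp', Bisection.L_R] at e2
  rw [e2, e1]

/-- The principaloid bundle of equivariant trivialisations of a `𝒢`-fibred `𝔹`-bundle. -/
def toPrincipaloidBundle (hred : 𝒢.IsIdReducible) (hdim : dM < dG ∨ Subsingleton M)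
    (𝒬 : GFibredBBundle dX dP 𝒢 π) : PrincipaloidBundle dX dP 𝒢 π where
  atlas := 𝒬.equivariantTrivs
  smooth _ hτ := hτ.1
  cover σ := by
    obtain ⟨τ, h1, h2, h3⟩ := 𝒬.locally_trivial σ
    exact ⟨τ, ⟨h2, h3⟩, h1⟩
  compatible _ hτ _ hτ' := lCompatible hred hdim hτ hτ'
  maximal _ hs h := mem_equivariantTrivs_of_lCompatible hs fun τ' hτ' => (h τ' hτ').1

/-- The trivialisations used to rebuild the action are equivariant for the original one, so both
actions are right translation in them. -/
theorem toGFibredBBundle_toPrincipaloidBundle (hred : 𝒢.IsIdReducible)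
    (hdim : dM < dG ∨ Subsingleton M) (𝒬 : GFibredBBundle dX dP 𝒢 π) :
    (𝒬.toPrincipaloidBundle hred hdim).toGFibredBBundle = 𝒬 := by
  refine ext_act (funext fun β => funext fun p => ?_)
  let 𝒜 := 𝒬.toPrincipaloidBundle hred hdim
  have hτ : 𝒜.trivAt (π p) ∈ 𝒬.equivariantTrivs := 𝒜.trivAt_mem (π p)
  have hp := 𝒜.mem_source_trivAt p
  have hp' : 𝒬.act β p ∈ (𝒜.trivAt (π p)).source := by
    rw [Bundle.Trivialization.mem_source, 𝒬.proj_act]; exact 𝒜.mem_trivAt _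
  refine (𝒜.trivAt (π p)).eq_of_apply_snd_eq hp' ?_ ?_
  · rw [𝒬.proj_act]; exact 𝒜.proj_act β p
  · rw [hτ.2 β p hp]
    exact congrArg Prod.snd (𝒜.apply_act (𝒜.trivAt_mem _) β hp)

end GFibredBBundle

variable [IsManifold (𝓡 dM) ∞ M] [T2Space M] [IsManifold (𝓡 dG) ∞ G]

/-- Trivialisations of the reduction are equivariant. Conversely, an equivariant one differs from
them by left translations, so maximality places it in the atlas. -/
theorem PrincipaloidBundle.toPrincipaloidBundle_toGFibredBBundle (hred : 𝒢.IsIdReducible)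
    (hdim : dM < dG ∨ Subsingleton M) (𝒜 : PrincipaloidBundle dX dP 𝒢 π) :
    𝒜.toGFibredBBundle.toPrincipaloidBundle hred hdim = 𝒜 := by
  have hsub : 𝒜.atlas ⊆ 𝒜.toGFibredBBundle.equivariantTrivs := fun τ hτ =>
    ⟨𝒜.smooth τ hτ, fun β _ hp => 𝒜.apply_act hτ β hp⟩
  refine ext_atlas (Set.Subset.antisymm (fun τ hτ => ?_) hsub)
  exact 𝒜.maximal τ hτ.1 fun τ' hτ' =>
    ⟨GFibredBBundle.lCompatible hred hdim hτ (hsub hτ'),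
      GFibredBBundle.lCompatible hred hdim (hsub hτ') hτ⟩

end Structures

/-! ### Derivatives at equal base points -/

section CongrPoint

variable {E E' H H' M N : Type*} [NormedAddCommGroup E] [NormedSpace ℝ E]
  [NormedAddCommGroup E'] [NormedSpace ℝ E'] [TopologicalSpace H] [TopologicalSpace H']
  {I : ModelWithCorners ℝ E H} {I' : ModelWithCorners ℝ E' H'}
  [TopologicalSpace M] [ChartedSpace H M] [TopologicalSpace N] [ChartedSpace H' N]

/-- The derivative is typed on the model spaces, so a base point known only up to a propositional
equality can be replaced without casts. -/
theorem HasMFDerivAt.congr_point {f : M → N} {x y : M} (h : x = y) {B : E →L[ℝ] E'}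
    (hB : HasMFDerivAt I I' f x B) : HasMFDerivAt I I' f y B := by
  subst h; exact hB

theorem HasMFDerivWithinAt.congr_point {f : M → N} {s : Set M} {x y : M} (h : x = y)
    {B : E →L[ℝ] E'} (hB : HasMFDerivWithinAt I I' f s x B) : HasMFDerivWithinAt I I' f s y B := by
  subst h; exact hB

end CongrPoint

/-! ### Derivatives within level sets of submersions -/

section LevelSets

variable {d d' : ℕ} {M N : Type*} [TopologicalSpace M] [ChartedSpace (EuclideanSpace ℝ (Fin d)) M]
  [IsManifold (𝓡 d) ∞ M] [TopologicalSpace N] [ChartedSpace (EuclideanSpace ℝ (Fin d')) N]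
  [IsManifold (𝓡 d') ∞ N]

/-- The kernel of the derivative of a submersion is tangent to the level set. -/
theorem mem_tangentConeAt_level {f : M → N} (hf : ContMDiff (𝓡 d) (𝓡 d') ∞ f) {p : M}
    (hs : Function.Surjective (mfderiv (𝓡 d) (𝓡 d') f p)) {v : EuclideanSpace ℝ (Fin d)}
    (hv : mfderiv (𝓡 d) (𝓡 d') f p v = 0) :
    v ∈ tangentConeAt ℝ ((extChartAt (𝓡 d) p).symm ⁻¹' {q | f q = f p}) (extChartAt (𝓡 d) p p) := by
  have hfd := hf.fderiv_writtenInExtChartAt p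
  have hfs := hf.eventually_contDiffAt_chart p
  set φ := extChartAt (𝓡 d) p with hφ
  set F := writtenInExtChartAt (𝓡 d) (𝓡 d') p f with hF
  have hFx : ∀ x, F x = extChartAt (𝓡 d') (f p) (f (φ.symm x)) := fun x => rfl
  have hsF : Function.Surjective (fderiv ℝ F (φ p)) := by rw [hfd]; exact hs
  have hvF : fderiv ℝ F (φ p) v = 0 := by rw [hfd]; exact hv
  obtain ⟨Λ, hΛs, hΛ1, hΛ2⟩ := exists_fibre_retraction hfs hsF
  have hΛd := (hΛs.self_of_nhds.differentiableAt (by simp)).hasFDerivAt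
  have hvert := fibre_retraction_deriv (hfs.self_of_nhds.differentiableAt (by simp)) hΛd hΛ2 hvF
  have hline : HasDerivAt (fun ε : ℝ => (F (φ p), φ p + ε • v))
      ((0 : EuclideanSpace ℝ (Fin d')), v) 0 := by
    have := (hasDerivAt_const (0 : ℝ) (F (φ p))).prodMk
      (((hasDerivAt_id (0 : ℝ)).smul_const v).const_add (φ p))
    simpa using this
  have hc : HasDerivAt (fun ε : ℝ => Λ (F (φ p), φ p + ε • v)) v 0 := by
    have := HasFDerivAt.comp_hasDerivAt (0 : ℝ) (f := fun ε : ℝ => (F (φ p), φ p + ε • v))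
      (by simpa only [zero_smul, add_zero] using hΛd) hline
    rwa [hvert] at this
  -- Retracting the straight line in the direction `v` gives a curve in the level set which still
  -- has velocity `v` at `0`.
  set c : ℝ → EuclideanSpace ℝ (Fin d) := fun ε => Λ (F (φ p), φ p + ε • v) with hcdef
  have hc0 : c 0 = φ p := by
    simp only [hcdef, zero_smul, add_zero]
    exact hΛ2.self_of_nhds
  have hlt : Filter.Tendsto (fun ε : ℝ => (F (φ p), φ p + ε • v)) (𝓝 0) (𝓝 (F (φ p), φ p)) := by
    simpa using hline.continuousAt.tendsto
  have hct : Filter.Tendsto (fun ε => f (φ.symm (c ε))) (𝓝 0) (𝓝 (f p)) := by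
    have h1 : Filter.Tendsto c (𝓝 0) (𝓝 (φ p)) := by rw [← hc0]; exact hc.continuousAt
    have h2 := (continuousAt_extChartAt_symm (I := 𝓡 d) p).tendsto
    rw [extChartAt_to_inv] at h2
    exact (hf.continuous.tendsto p).comp (h2.comp h1)
  have hlev : ∀ᶠ ε in 𝓝 (0 : ℝ), c ε ∈ φ.symm ⁻¹' {q | f q = f p} := by
    filter_upwards [hlt.eventually hΛ1, hct (extChartAt_source_mem_nhds (I := 𝓡 d') (f p))]
      with ε h1 h2
    change F (c ε) = F (φ p) at h1
    rw [hFx, hFx, extChartAt_to_inv] at h1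
    exact (extChartAt (𝓡 d') (f p)).injOn h2 (mem_extChartAt_source _) h1
  -- The admissible parameters form a neighbourhood of `0`, so their tangent cone is the whole line
  -- and the derivative of `c` carries `1` to `v`.
  have h1 : (1 : ℝ) ∈ tangentConeAt ℝ {ε | c ε ∈ φ.symm ⁻¹' {q | f q = f p}} 0 := by
    rw [tangentConeAt_of_mem_nhds hlev]; trivial
  have h2 := hc.hasFDerivAt.hasFDerivWithinAt.mapsTo_tangent_cone h1
  rw [hc0] at h2
  have hsub : c '' {ε | c ε ∈ φ.symm ⁻¹' {q | f q = f p}} ⊆ φ.symm ⁻¹' {q | f q = f p} := by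
    rintro _ ⟨ε, hε, rfl⟩
    exact hε
  have h3 := tangentConeAt_mono hsub h2
  simpa using h3

/-- Derivatives within a level set of a submersion agree on the kernel of its derivative. -/
theorem HasMFDerivWithinAt.eq_on_ker_of_level {d'' : ℕ} {N' : Type*} [TopologicalSpace N']
    [ChartedSpace (EuclideanSpace ℝ (Fin d'')) N'] {f : M → N}
    (hf : ContMDiff (𝓡 d) (𝓡 d') ∞ f) {p : M}
    (hs : Function.Surjective (mfderiv (𝓡 d) (𝓡 d') f p)) {h : M → N'}
    {D D' : EuclideanSpace ℝ (Fin d) →L[ℝ] EuclideanSpace ℝ (Fin d'')}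
    (hD : HasMFDerivWithinAt (𝓡 d) (𝓡 d'') h {q | f q = f p} p D)
    (hD' : HasMFDerivWithinAt (𝓡 d) (𝓡 d'') h {q | f q = f p} p D')
    {v : EuclideanSpace ℝ (Fin d)} (hv : mfderiv (𝓡 d) (𝓡 d') f p v = 0) : D v = D' v := by
  have hset : (extChartAt (𝓡 d) p).symm ⁻¹' {q | f q = f p} ∩ Set.range (𝓡 d) =
      (extChartAt (𝓡 d) p).symm ⁻¹' {q | f q = f p} := by simp
  have h1 : HasFDerivWithinAt (writtenInExtChartAt (𝓡 d) (𝓡 d'') p h) D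
    ((extChartAt (𝓡 d) p).symm ⁻¹' {q | f q = f p}) (extChartAt (𝓡 d) p p) := hset ▸ hD.2
  have h2 : HasFDerivWithinAt (writtenInExtChartAt (𝓡 d) (𝓡 d'') p h) D'
    ((extChartAt (𝓡 d) p).symm ⁻¹' {q | f q = f p}) (extChartAt (𝓡 d) p p) := hset ▸ hD'.2
  exact HasFDerivWithinAt.unique_on h1 h2 (mem_tangentConeAt_level hf hs hv)

end LevelSets

/-! ### The correspondence between compatible connections -/

section Connections

variable {dM dG dX dP : ℕ} {M G X P : Type*}
  [TopologicalSpace M] [ChartedSpace (EuclideanSpace ℝ (Fin dM)) M]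
  [TopologicalSpace G] [ChartedSpace (EuclideanSpace ℝ (Fin dG)) G]
  [TopologicalSpace X] [ChartedSpace (EuclideanSpace ℝ (Fin dX)) X]
  [TopologicalSpace P] [ChartedSpace (EuclideanSpace ℝ (Fin dP)) P]
  {𝒢 : LieGroupoid dM dG M G} {π : P → X}

/-- Restricted to a fibre of `π`, identified with `G` by a trivialisation, `μ` is the submersion
`s`. -/
theorem PrincipaloidBundle.mfderiv_moment_surjective (𝒜 : PrincipaloidBundle dX dP 𝒢 π) (p : P) :
    Function.Surjective (mfderiv (𝓡 dP) (𝓡 dM) 𝒜.moment p) := by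
  set τ := 𝒜.trivAt (π p)
  have hτ : τ ∈ 𝒜.atlas := 𝒜.trivAt_mem _
  have hp : p ∈ τ.source := 𝒜.mem_source_trivAt p
  have hb : π p ∈ τ.baseSet := 𝒜.mem_trivAt _
  have hj : ContMDiffAt (𝓡 dG) (𝓡 dP) ∞ (fun g => τ.toOpenPartialHomeomorph.symm (π p, g))
      (τ p).2 :=
    ContMDiffAt.comp (τ p).2 (f := fun g => (π p, g))
      ((𝒜.smooth τ hτ).contMDiffAt_symm (y := (π p, (τ p).2)) hb)
      (contMDiffAt_const.prodMk contMDiffAt_id)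
  have hjd := (hj.mdifferentiableAt (by simp)).hasMFDerivAt
  have hμ := (𝒜.contMDiff_moment.mdifferentiable (by simp) p).hasMFDerivAt
  have hjp : τ.toOpenPartialHomeomorph.symm (π p, (τ p).2) = p := τ.symm_proj_snd hp
  have hs : 𝒢.s = fun g => 𝒜.moment (τ.toOpenPartialHomeomorph.symm (π p, g)) := by
    funext g
    rw [𝒜.moment_eq hτ _ (τ.mem_source.1 (τ.symm_mem_source hb g)), τ.apply_symm_apply' hb]
  have hcomp := HasMFDerivAt.comp (τ p).2 (HasMFDerivAt.congr_point hjp.symm hμ) hjd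
  have hsd := hasMFDerivAt_unique
    (𝒢.smooth_s.mdifferentiable (by simp) (τ p).2).hasMFDerivAt
    (hcomp.congr_of_eventuallyEq (Filter.Eventually.of_forall (congrFun hs)))
  intro a
  obtain ⟨w, hw⟩ := 𝒢.submersion_s (τ p).2 a
  exact ⟨_, (congrArg (fun L => L w) hsd).symm.trans hw⟩

variable [IsManifold (𝓡 dP) ∞ P]

theorem EhresmannConnection.H_congr (C : EhresmannConnection dX dP π) {p q : P} (h : p = q) :
    (C.H p : Submodule ℝ (EuclideanSpace ℝ (Fin dP))) = C.H q := by
  subst h; rfl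

/-- A vertical automorphism fixing a point and preserving the horizontal space there acts
trivially on it. -/
theorem EhresmannConnection.apply_eq_self (C : EhresmannConnection dX dP π) {p : P}
    (hπ : MDifferentiableAt (𝓡 dP) (𝓡 dX) π p) {f : P → P} (hπf : ∀ q, π (f q) = π q)
    (hfp : f p = p) {D : EuclideanSpace ℝ (Fin dP) →L[ℝ] EuclideanSpace ℝ (Fin dP)}
    (hf : HasMFDerivAt (𝓡 dP) (𝓡 dP) f p D) {v : EuclideanSpace ℝ (Fin dP)} (hv : v ∈ C.H p)
    (hDv : D v ∈ C.H p) : D v = v := by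
  have h1 := hπ.hasMFDerivAt
  have h2 := HasMFDerivAt.comp p (HasMFDerivAt.congr_point hfp.symm h1) hf
  have h3 : π ∘ f = π := funext hπf
  rw [h3] at h2
  have h4 : mfderiv (𝓡 dP) (𝓡 dX) π p (D v) = mfderiv (𝓡 dP) (𝓡 dX) π p v :=
    (congrArg (fun L => L v) (hasMFDerivAt_unique h1 h2)).symm
  have h5 : D v - v ∈ (mfderiv (𝓡 dP) (𝓡 dX) π p).ker := by
    change mfderiv (𝓡 dP) (𝓡 dX) π p (D v - v) = 0
    exact (map_sub (mfderiv (𝓡 dP) (𝓡 dX) π p) (D v) v).trans (sub_eq_zero.2 h4)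
  have h6 : D v - v ∈ (mfderiv (𝓡 dP) (𝓡 dX) π p).ker ⊓ C.H p := ⟨h5, (C.H p).sub_mem hDv hv⟩
  rw [(C.isCompl p).inf_eq_bot] at h6
  exact sub_eq_zero.1 ((Submodule.mem_bot ℝ).1 h6)

variable [IsManifold (𝓡 dM) ∞ M]

/-- On the level set of `μ` through `p` the action of `β` is `ϱ_g` for a single arrow `g`, so the
two derivatives agree on `ker T_pμ`, which contains `H_p`. -/
theorem PrincipaloidBundle.IsCompatible.toGFibredBBundle {𝒜 : PrincipaloidBundle dX dP 𝒢 π}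
    {C : EhresmannConnection dX dP π} (h : 𝒜.IsCompatible C) :
    𝒜.toGFibredBBundle.IsCompatible C := by
  intro β p
  obtain ⟨D, hD, hDH⟩ := h.2 (β (β.shadow.symm (𝒜.moment p))) p (β.t_shadow_symm _).symm
  have hset : {q | 𝒜.moment q = 𝒢.t (β (β.shadow.symm (𝒜.moment p)))} =
      {q | 𝒜.moment q = 𝒜.moment p} := by rw [β.t_shadow_symm]
  rw [hset] at hD
  have hact := ((𝒜.contMDiff_act β).mdifferentiable (by simp) p).hasMFDerivAt
  have hactw : HasMFDerivWithinAt (𝓡 dP) (𝓡 dP)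
      (fun q => 𝒜.rho q (β (β.shadow.symm (𝒜.moment p)))) {q | 𝒜.moment q = 𝒜.moment p} p
      (mfderiv (𝓡 dP) (𝓡 dP) (𝒜.act β) p) := by
    refine hact.hasMFDerivWithinAt.congr_of_eventuallyEq ?_ rfl
    filter_upwards [self_mem_nhdsWithin] with q hq
    rw [PrincipaloidBundle.act, show 𝒜.moment q = 𝒜.moment p from hq]
  refine Eq.trans ?_ hDH
  refine SetLike.coe_injective (Set.image_congr fun v hv => ?_)
  have hv' : mfderiv (𝓡 dP) (𝓡 dM) 𝒜.moment p v = 0 := h.1 p hv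
  exact HasMFDerivWithinAt.eq_on_ker_of_level 𝒜.contMDiff_moment (𝒜.mfderiv_moment_surjective p)
    hactw hD hv'

namespace PrincipaloidBundle

variable {𝒜 : PrincipaloidBundle dX dP 𝒢 π} {C : EhresmannConnection dX dP π}

omit [IsManifold (𝓡 dP) ∞ P] [IsManifold (𝓡 dM) ∞ M] in
theorem act_eq_self {β : Bisection 𝒢} {p : P}
    (hβ : β (𝒜.moment p) = 𝒢.ident (𝒜.moment p)) : 𝒜.act β p = p := by
  have hp := 𝒜.mem_source_trivAt p
  refine (𝒜.trivAt (π p)).eq_of_apply_snd_eq hp (𝒜.proj_act β p) ?_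
  rw [apply_act (𝒜.trivAt_mem _) β hp]
  rw [𝒜.moment_eq (𝒜.trivAt_mem (π p)) p (𝒜.mem_trivAt _)] at hβ
  exact β.R_ident_of_apply_eq hβ

omit [IsManifold (𝓡 dP) ∞ P] [IsManifold (𝓡 dM) ∞ M] in
/-- If a bisection is trivial at `μ(p)`, then its derivative agrees with that of the unit section on
the image under `Tμ` of the vectors fixed by the action of the bisection. -/
theorem mfderiv_bisection_eq {β : Bisection 𝒢} {p : P}
    (hβ : β (𝒜.moment p) = 𝒢.ident (𝒜.moment p)) {v : EuclideanSpace ℝ (Fin dP)}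
    (hv : (mfderiv (𝓡 dP) (𝓡 dP) (𝒜.act β) p v : EuclideanSpace ℝ (Fin dP)) = v) :
    (mfderiv (𝓡 dM) (𝓡 dG) β (𝒜.moment p) (mfderiv (𝓡 dP) (𝓡 dM) 𝒜.moment p v) :
      EuclideanSpace ℝ (Fin dG)) =
    mfderiv (𝓡 dM) (𝓡 dG) 𝒢.ident (𝒜.moment p) (mfderiv (𝓡 dP) (𝓡 dM) 𝒜.moment p v) := by
  set τ := 𝒜.trivAt (π p)
  have hτ : τ ∈ 𝒜.atlas := 𝒜.trivAt_mem _
  have hp : p ∈ τ.source := 𝒜.mem_source_trivAt p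
  have hfix : 𝒜.act β p = p := act_eq_self hβ
  have hact := ((𝒜.contMDiff_act β).mdifferentiable (by simp) p).hasMFDerivAt
  have hμ := (𝒜.contMDiff_moment.mdifferentiable (by simp) p).hasMFDerivAt
  have hfib := (((𝒜.smooth τ hτ).contMDiffAt_fibre hp).mdifferentiableAt (by simp)).hasMFDerivAt
  set g := (τ p).2 with hg
  -- Multiplying the fibre coordinate of `β`'s action on `q` by the inverse of that of `q` gives
  -- `β((t_*β)⁻¹(μ(q)))`; with `q` in place of its image it gives the unit at `μ(q)`. Both products
  -- are differentiated at `p`.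
  have hinv := ((𝒢.smooth_inv.mdifferentiable (by simp) g).hasMFDerivAt).comp p hfib
  have hfib' := HasMFDerivAt.comp p (HasMFDerivAt.congr_point hfix.symm hfib) hact
  have hpair₁ := hinv.prodMk hfib'
  have hpair₂ := hinv.prodMk hfib
  have hmul := (𝒢.smooth_mul.mdifferentiableOn (by simp) (𝒢.inv g, g) (𝒢.s_inv g)).hasMFDerivWithinAt
  have hmem : τ.source ∈ 𝓝 p := τ.open_source.mem_nhds hp
  have hc₁ := (HasMFDerivWithinAt.comp p (HasMFDerivWithinAt.congr_point
    (show (𝒢.inv g, g) = (𝒢.inv g, (τ (𝒜.act β p)).2) by rw [hfix]) hmul)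
    (hpair₁.hasMFDerivWithinAt (s := τ.source)) (fun q hq => by
      change 𝒢.s (𝒢.inv (τ q).2) = 𝒢.t (τ (𝒜.act β q)).2
      rw [apply_act hτ β hq, β.t_R, 𝒢.s_inv])).hasMFDerivAt hmem
  have hc₂ := (HasMFDerivWithinAt.comp p hmul
    (hpair₂.hasMFDerivWithinAt (s := τ.source)) (fun q _ => 𝒢.s_inv (τ q).2)).hasMFDerivAt hmem
  have hm : β.shadow.symm (𝒜.moment p) = 𝒜.moment p := by
    conv_lhs => rw [← 𝒢.t_ident (𝒜.moment p), ← hβ]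
    exact β.shadow_symm_t _
  have hB := (β.smooth.mdifferentiable (by simp) (𝒜.moment p)).hasMFDerivAt
  have hJ := (𝒢.smooth_ident.mdifferentiable (by simp) (𝒜.moment p)).hasMFDerivAt
  have hSh := (β.shadow.symm.contMDiff.mdifferentiable (by simp) (𝒜.moment p)).hasMFDerivAt
  have hSd := (𝒢.smooth_s.mdifferentiable (by simp) (𝒢.ident (𝒜.moment p))).hasMFDerivAt
  have hc₁' := HasMFDerivAt.comp p
    (HasMFDerivAt.comp (𝒜.moment p) (HasMFDerivAt.congr_point hm.symm hB) hSh) hμ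
  have hc₂' := HasMFDerivAt.comp p hJ hμ
  have e₁ := hasMFDerivAt_unique hc₁' (hc₁.congr_of_eventuallyEq (by
    filter_upwards [hmem] with q hq
    change β (β.shadow.symm (𝒜.moment q)) = 𝒢.mul (𝒢.inv (τ q).2) (τ (𝒜.act β q)).2
    rw [apply_act hτ β hq, 𝒜.moment_eq hτ q (τ.mem_source.1 hq)]
    have ht := β.t_shadow_symm (𝒢.s (τ q).2)
    rw [Bisection.R, ← 𝒢.mul_assoc _ _ _ (𝒢.s_inv _) ht.symm, 𝒢.inv_mul]
    have hu := 𝒢.ident_mul (β (β.shadow.symm (𝒢.s (τ q).2)))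
    rw [ht] at hu
    exact hu.symm))
  have e₂ := hasMFDerivAt_unique hc₂' (hc₂.congr_of_eventuallyEq (by
    filter_upwards [hmem] with q hq
    change 𝒢.ident (𝒜.moment q) = 𝒢.mul (𝒢.inv (τ q).2) (τ q).2
    rw [𝒜.moment_eq hτ q (τ.mem_source.1 hq), 𝒢.inv_mul]))
  have e₃ := hasMFDerivAt_unique (hasMFDerivAt_id (𝒜.moment p))
    ((HasMFDerivAt.comp (𝒜.moment p) (HasMFDerivAt.congr_point hβ.symm hSd) hB).congr_of_eventuallyEq
      (Filter.Eventually.of_forall fun m => (β.s_toFun m).symm))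
  have e₄ := hasMFDerivAt_unique (hasMFDerivAt_id (𝒜.moment p))
    ((HasMFDerivAt.comp (𝒜.moment p) hSd hJ).congr_of_eventuallyEq
      (Filter.Eventually.of_forall fun m => (𝒢.s_ident m).symm))
  set B := mfderiv (𝓡 dM) (𝓡 dG) β (𝒜.moment p)
  set J := mfderiv (𝓡 dM) (𝓡 dG) 𝒢.ident (𝒜.moment p)
  set Mu := mfderiv (𝓡 dP) (𝓡 dM) 𝒜.moment p
  set Sh := mfderiv (𝓡 dM) (𝓡 dM) β.shadow.symm (𝒜.moment p)
  -- The two products differ only in the second factor, whose derivatives along `v` agree by `hv`.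
  -- The same within-derivative of `mul` occurs in both, so its uniqueness plays no role.
  have f₁ : B (Sh (Mu v)) = J (Mu v) := by
    refine (congrArg (fun L => L v) e₁).trans (Eq.trans ?_ (congrArg (fun L => L v) e₂).symm)
    exact congrArg (fun w => mfderivWithin ((𝓡 dG).prod (𝓡 dG)) (𝓡 dG)
      (fun x : G × G => 𝒢.mul x.1 x.2) {x | 𝒢.s x.1 = 𝒢.t x.2} (𝒢.inv g, g)
      (mfderiv (𝓡 dG) (𝓡 dG) 𝒢.inv g (mfderiv (𝓡 dP) (𝓡 dG) (fun q => (τ q).2) p v),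
        mfderiv (𝓡 dP) (𝓡 dG) (fun q => (τ q).2) p w)) hv
  -- Apply `Ts` to `f₁`: both `β` and the unit map are sections of `s`.
  have f₂ : Sh (Mu v) = Mu v :=
    (congrArg (fun L => L (Sh (Mu v))) e₃).trans
      ((congrArg (mfderiv (𝓡 dG) (𝓡 dM) 𝒢.s (𝒢.ident (𝒜.moment p))) f₁).trans
        (congrArg (fun L => L (Mu v)) e₄).symm)
  exact (congrArg B f₂).symm.trans f₁

end PrincipaloidBundle

/-- Invariance under bisections trivial at `μ(p)` forces `H_p` into `ker Tμ`, and a bisection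
through `g` then realises `ϱ_g` on the level set of `μ`. -/
theorem PrincipaloidBundle.isCompatible_of_toGFibredBBundle [IsManifold (𝓡 dG) ∞ G] [T2Space M]
    (hred : 𝒢.IsIdReducible) (hdim : dM < dG ∨ Subsingleton M)
    {𝒜 : PrincipaloidBundle dX dP 𝒢 π} {C : EhresmannConnection dX dP π}
    (h : 𝒜.toGFibredBBundle.IsCompatible C) : 𝒜.IsCompatible C := by
  refine ⟨fun p v hv => ?_, fun g p hg => ?_⟩
  · rw [LinearMap.mem_ker]
    rcases hdim with hd | hM
    · by_contra hne
      obtain ⟨β, hβ, hβ'⟩ := 𝒢.exists_bisection_mfderiv_ne hd (𝒜.moment p) _ hne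
      refine hβ' (mfderiv_bisection_eq hβ ?_)
      have hfix : 𝒜.act β p = p := act_eq_self hβ
      have hact := ((𝒜.contMDiff_act β).mdifferentiable (by simp) p).hasMFDerivAt
      have hπ := ((𝒜.smooth _ (𝒜.trivAt_mem (π p))).contMDiffAt_proj
        (𝒜.mem_source_trivAt p)).mdifferentiableAt (by simp)
      refine C.apply_eq_self hπ (𝒜.proj_act β) hfix hact hv ?_
      have h1 : (C.H p).map (mfderiv (𝓡 dP) (𝓡 dP) (𝒜.act β) p).toLinearMap =
        C.H (𝒜.act β p) := h β p
      have h2 := Submodule.mem_map_of_mem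
        (f := (mfderiv (𝓡 dP) (𝓡 dP) (𝒜.act β) p).toLinearMap) hv
      rw [h1] at h2
      rw [← C.H_congr hfix]
      exact h2
    · have : 𝒜.moment = fun _ => 𝒜.moment p := funext fun _ => Subsingleton.elim _ _
      rw [this, mfderiv_const]
      rfl
  · obtain ⟨β, hβ⟩ := hred g
    have hsh : β.shadow.symm (𝒜.moment p) = 𝒢.s g := by
      rw [hg]
      conv_lhs => rw [← hβ]
      exact β.shadow_symm_t _
    have hq : ∀ q, 𝒜.moment q = 𝒢.t g → 𝒜.rho q g = 𝒜.act β q := by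
      intro q hq
      rw [PrincipaloidBundle.act, hq, ← hg, hsh, hβ]
    have hact := ((𝒜.contMDiff_act β).mdifferentiable (by simp) p).hasMFDerivAt
    refine ⟨mfderiv (𝓡 dP) (𝓡 dP) (𝒜.act β) p, ?_, ?_⟩
    · refine hact.hasMFDerivWithinAt.congr_of_eventuallyEq ?_ (hq p hg)
      filter_upwards [self_mem_nhdsWithin] with q h1
      exact hq q h1
    · exact (h β p).trans (C.H_congr (hq p hg).symm)

end Connections

theorem mainTheorem7 {dM dG dX dP : ℕ} {M G X P : Type*}
    [TopologicalSpace M] [ChartedSpace (EuclideanSpace ℝ (Fin dM)) M]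
    [IsManifold (𝓡 dM) ∞ M] [T2Space M] [SecondCountableTopology M]
    [TopologicalSpace G] [ChartedSpace (EuclideanSpace ℝ (Fin dG)) G]
    [IsManifold (𝓡 dG) ∞ G] [T2Space G] [SecondCountableTopology G]
    [TopologicalSpace X] [ChartedSpace (EuclideanSpace ℝ (Fin dX)) X]
    [IsManifold (𝓡 dX) ∞ X] [T2Space X] [SecondCountableTopology X]
    [TopologicalSpace P] [ChartedSpace (EuclideanSpace ℝ (Fin dP)) P]
    [IsManifold (𝓡 dP) ∞ P] [T2Space P] [SecondCountableTopology P]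
    (𝒢 : LieGroupoid dM dG M G) (hred : 𝒢.IsIdReducible)
    (hdim : dM < dG ∨ Subsingleton M) (π : P → X) :
    ∃ Φ : {x : PrincipaloidBundle dX dP 𝒢 π × EhresmannConnection dX dP π //
              x.1.IsCompatible x.2} ≃
          {y : GFibredBBundle dX dP 𝒢 π × EhresmannConnection dX dP π //
              y.1.IsCompatible y.2},
      ∀ x, (Φ x).1.2 = x.1.2 ∧
        (∀ τ ∈ x.1.1.atlas, ∀ (β : Bisection 𝒢), ∀ p ∈ τ.source,
          τ ((Φ x).1.1.act β p) = (π p, β.R (τ p).2)) ∧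
        ∀ (β : Bisection 𝒢) (p : P),
          (Φ x).1.1.act β p = x.1.1.rho p (β (β.shadow.symm (x.1.1.moment p))) := by
  let Φ : {x : PrincipaloidBundle dX dP 𝒢 π × EhresmannConnection dX dP π //
        x.1.IsCompatible x.2} ≃
      {y : GFibredBBundle dX dP 𝒢 π × EhresmannConnection dX dP π // y.1.IsCompatible y.2} :=
    { toFun := fun x => ⟨(x.1.1.toGFibredBBundle, x.1.2), x.2.toGFibredBBundle⟩
      invFun := fun y => ⟨(y.1.1.toPrincipaloidBundle hred hdim, y.1.2),
        PrincipaloidBundle.isCompatible_of_toGFibredBBundle hred hdim (by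
          rw [y.1.1.toGFibredBBundle_toPrincipaloidBundle hred hdim]
          exact y.2)⟩
      left_inv := fun x => Subtype.ext (Prod.ext
        (x.1.1.toPrincipaloidBundle_toGFibredBBundle hred hdim) rfl)
      right_inv := fun y => Subtype.ext (Prod.ext
        (y.1.1.toGFibredBBundle_toPrincipaloidBundle hred hdim) rfl) }
  exact ⟨Φ, fun x => ⟨rfl, fun τ hτ β p hp => PrincipaloidBundle.apply_act hτ β hp,
    fun β p => rfl⟩⟩
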